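/- For a finite simple graph $G=(V,E)$, a positive integer $q$ and $w\in\mathbb{C}$, let $$Z_G(q;w)=\sum_{\phi:V\to\{1,\dots,q\}} w^{m(\phi)},$$ where $m(\phi)$ is the number of edges $\{u,v\}\in E$ with $\phi(u)=\phi(v)$ (and $w^0=1$), be the partition function of the $q$-state Potts model. There exists a real constant $\eta\ge 0.002$ such that for all integers $\Delta\ge 3$ and $q\ge(2-\eta)\Delta$ there exists an open set $\mathcal{U}\subset\mathbb{C}$ containing the real interval $[0,1]$ such that $Z_G(q;w)\ne 0$ for every $w\in\mathcal{U}$ and every finite simple graph $G$ of maximum degree at most $\Delta$. -/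

import Mathlib

/-- The number `m(φ)` of edges `{u, v}` of `G` with `φ u = φ v`. -/
def monoEdgeCount {V : Type*} [Fintype V] [DecidableEq V] (G : SimpleGraph V)
    [DecidableRel G.Adj] {q : ℕ} (φ : V → Fin q) : ℕ :=
  (G.edgeFinset.filter (fun e => (Sym2.map φ e).IsDiag)).card

/-- The partition function `Z_G(q; w) = ∑_{φ : V → [q]} w ^ m(φ)` of the `q`-state Potts model. -/
def pottsZ {V : Type*} [Fintype V] [DecidableEq V] (G : SimpleGraph V)
    [DecidableRel G.Adj] (q : ℕ) (w : ℂ) : ℂ :=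
  ∑ φ : V → Fin q, w ^ monoEdgeCount G φ

set_option linter.unusedSectionVars false

open Finset

namespace PinnedPotts

variable {V : Type*} [Fintype V] [DecidableEq V] {q : ℕ}

/-! The class of graphs is enlarged by pins, unary penalties `w` for giving a vertex a colour, so
that deleting a vertex `u` with a prescribed colour stays inside the class: each neighbour loses an
edge and gains a pin, and no load exceeds `Δ`. Near a real `w₀ ∈ [0, 1]` the relative change of the
partition function is tracked by induction on a set `S` containing all vertices of positive load
(`goodOn`). The claim carried along is that, around a vertex, the changes for different colours have
the form `κ * exp (δ l)` with `δ` nearly constant in `l` (`Controlled`); a sum of positive terms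
perturbed in this way cannot vanish.

To compare two colours at a removed vertex, the pins of its neighbours are switched one at a time
(`changeZ_removed_step`). Each switch is a log-ratio at a neighbour of load at most `Δ - 1`, whose
first order part is `linearPart`. Its coefficients satisfy `coef ≤ 1 / (q - Δ)`. For `q ≥ 2 * Δ` a
switch thus costs at most `M / Δ`, and at most `Δ - 1` switches contract by `1 - 1 / Δ`.

For `q < 2 * Δ` a gain has to be found (`norm_linearPart_mul_le`). The bound on `coef` is nearly
attained only if colour `i` is almost surely available at `u`. Then supermodularity and telescoping
bound the total cost of switching from `l` to `i` by about `-log (avail l)` (`spread_le_log`). The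
availabilities sum to at least `q - deg u`, so the average of this cost, truncated at `1`, is at
most `0.95`. This beats the loss of a factor `0.998`. Second order errors are absorbed by taking
`M`, and then the radius `r`, small in terms of `Δ` and `q` only (`exists_parameters`). -/

/-- The exponent of a colouring `φ`: monochromatic edges of `E` plus violated pins, where
`b v l` is the number of pins of colour `l` attached to `v`. -/
def cost (E : Finset (Sym2 V)) (b : V → Fin q → ℕ) (φ : V → Fin q) : ℕ :=
  (E.filter fun e => (Sym2.map φ e).IsDiag).card + ∑ v, b v (φ v)

/-- The Potts partition function of the graph with edge set `E` and pins `b`. -/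
def pinnedZ {R : Type*} [CommSemiring R] (w : R) (E : Finset (Sym2 V)) (b : V → Fin q → ℕ) : R :=
  ∑ φ : V → Fin q, w ^ cost E b φ

/-- The neighbours of `u`. -/
def nbr (E : Finset (Sym2 V)) (u : V) : Finset V := univ.filter fun v => s(u, v) ∈ E

/-- The degree of `v`, pins included. -/
def load (E : Finset (Sym2 V)) (b : V → Fin q → ℕ) (v : V) : ℕ := (nbr E v).card + ∑ l, b v l

/-- A single pin of colour `i` at `v`. -/
def pin (v : V) (i : Fin q) : V → Fin q → ℕ := Pi.single v (Pi.single i 1)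

/-- The edges that avoid `u`. -/
def cut (E : Finset (Sym2 V)) (u : V) : Finset (Sym2 V) := E.filter fun e => u ∉ e

/-- The pins that are not at `u`. -/
def clear (b : V → Fin q → ℕ) (u : V) : V → Fin q → ℕ := Function.update b u 0

/-- No loops. -/
def Loopless (E : Finset (Sym2 V)) : Prop := ∀ v, s(v, v) ∉ E

/-- The partition function after removing `u` with colour `l` imposed on `u`, without the pins at
`u`. -/
def removedZ {R : Type*} [CommSemiring R] (w : R) (E : Finset (Sym2 V)) (b : V → Fin q → ℕ) (u : V)
    (l : Fin q) : R :=
  pinnedZ w (cut E u) (clear b u + ∑ v ∈ nbr E u, pin v l)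

/-! ### Vertex removal in the pinned model. -/

lemma pottsZ_eq_pinnedZ (G : SimpleGraph V) [DecidableRel G.Adj] (w : ℂ) :
    pottsZ G q w = pinnedZ (q := q) w G.edgeFinset 0 := by
  simp [pottsZ, pinnedZ, cost, monoEdgeCount]

lemma mem_nbr {E : Finset (Sym2 V)} {u v : V} : v ∈ nbr E u ↔ s(u, v) ∈ E := by
  simp [nbr]

lemma Loopless.cut {E : Finset (Sym2 V)} (hE : Loopless E) (u : V) : Loopless (cut E u) :=
  fun v hv => hE v (mem_filter.1 hv).1

lemma Loopless.not_mem_nbr {E : Finset (Sym2 V)} (hE : Loopless E) (u : V) : u ∉ nbr E u :=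
  fun h => hE u (mem_nbr.1 h)

lemma pin_apply (v x : V) (i l : Fin q) : pin v i x l = if v = x ∧ l = i then 1 else 0 := by
  unfold pin
  by_cases h : v = x
  · subst h; simp [Pi.single_apply]
  · simp [h]

lemma sum_pin (v x : V) (i : Fin q) : ∑ l, pin v i x l = if v = x then 1 else 0 := by
  by_cases h : v = x <;> simp [pin_apply, h]

lemma cost_add (E : Finset (Sym2 V)) (b c : V → Fin q → ℕ) (φ : V → Fin q) :
    cost E (b + c) φ = cost E b φ + ∑ v, c v (φ v) := by
  simp [cost, sum_add_distrib, add_assoc]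

lemma clear_self (b : V → Fin q → ℕ) (u : V) : clear b u u = 0 := by simp [clear]

lemma clear_of_ne (b : V → Fin q → ℕ) {u v : V} (h : v ≠ u) : clear b u v = b v := by
  simp [clear, h]

lemma clear_add_pin (b : V → Fin q → ℕ) (u : V) (i : Fin q) : clear (b + pin u i) u = clear b u := by
  funext v
  by_cases h : v = u
  · subst h; simp [clear_self]
  · rw [clear_of_ne _ h, clear_of_ne _ h]
    simp [pin, h]

lemma removedZ_add_pin {R : Type*} [CommSemiring R] (w : R) (E : Finset (Sym2 V))
    (b : V → Fin q → ℕ) (u : V) (i l : Fin q) :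
    removedZ w E (b + pin u i) u l = removedZ w E b u l := by
  rw [removedZ, clear_add_pin, removedZ]

lemma sum_clear (b : V → Fin q → ℕ) (u : V) (φ : V → Fin q) :
    ∑ v, b v (φ v) = ∑ v, clear b u v (φ v) + b u (φ u) := by
  rw [← add_sum_erase univ (fun v => b v (φ v)) (mem_univ u),
    ← add_sum_erase univ (fun v => clear b u v (φ v)) (mem_univ u)]
  simp only [clear_self, Pi.zero_apply, zero_add]
  rw [add_comm]
  congr 1
  exact sum_congr rfl fun v hv => by rw [clear_of_ne _ (ne_of_mem_erase hv)]

lemma sum_sum_pin (N : Finset V) (l : Fin q) (φ : V → Fin q) :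
    ∑ v, (∑ x ∈ N, pin x l) v (φ v) = (N.filter fun x => φ x = l).card := by
  simp only [Finset.sum_apply, pin_apply]
  rw [sum_comm, card_filter]
  refine sum_congr rfl fun x _ => ?_
  rw [sum_eq_single x] <;> simp +contextual [eq_comm]

lemma card_mono_split {E : Finset (Sym2 V)} (u : V) (φ : V → Fin q) :
    (E.filter fun e => (Sym2.map φ e).IsDiag).card =
      ((cut E u).filter fun e => (Sym2.map φ e).IsDiag).card +
        ((nbr E u).filter fun x => φ x = φ u).card := by
  rw [← card_filter_add_card_filter_not (s := E.filter fun e => (Sym2.map φ e).IsDiag)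
    (fun e => u ∉ e)]
  congr 1
  · rw [cut, filter_filter, filter_filter]
    simp only [and_comm]
  · symm
    apply card_bij (fun x _ => s(u, x))
    · intro x hx
      simp only [mem_filter, mem_nbr] at hx
      simp [hx.1, hx.2]
    · intro x _ y _ h
      exact Sym2.congr_right.1 h
    · intro e he
      simp only [mem_filter, not_not] at he
      obtain ⟨⟨heE, hd⟩, hu⟩ := he
      obtain ⟨x, rfl⟩ := hu
      refine ⟨x, ?_, rfl⟩
      simp only [Sym2.map_mk, Sym2.mk_isDiag_iff] at hd
      simp [mem_nbr, heE, hd]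

lemma cost_split (E : Finset (Sym2 V)) (b : V → Fin q → ℕ) (u : V) (φ : V → Fin q) :
    cost E b φ =
      b u (φ u) + cost (cut E u) (clear b u + ∑ v ∈ nbr E u, pin v (φ u)) φ := by
  rw [cost_add, sum_sum_pin, cost, cost, card_mono_split u, sum_clear b u]
  ring

/-- After removal `u` is isolated and unpinned; looplessness ensures that none of the new pins lands
on `u` itself. -/
lemma cost_cut_update {E : Finset (Sym2 V)} (hE : Loopless E) (b : V → Fin q → ℕ) (u : V)
    (l m : Fin q) (φ : V → Fin q) :
    cost (cut E u) (clear b u + ∑ v ∈ nbr E u, pin v l) (Function.update φ u m) =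
      cost (cut E u) (clear b u + ∑ v ∈ nbr E u, pin v l) φ := by
  have h1 : ∀ e ∈ cut E u, Sym2.map (Function.update φ u m) e = Sym2.map φ e := by
    intro e he
    refine Sym2.map_congr fun x hx => ?_
    have : x ≠ u := by
      rintro rfl
      exact (mem_filter.1 he).2 hx
    simp [this]
  unfold cost
  congr 1
  · congr 1
    exact filter_congr fun e he => by rw [h1 e he]
  · refine sum_congr rfl fun v _ => ?_
    by_cases hv : v = u
    · subst hv
      have : ∀ k : Fin q, (∑ x ∈ nbr E v, pin x l) v k = 0 := by
        intro k
        simp only [Finset.sum_apply, pin_apply]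
        refine sum_eq_zero fun x hx => ?_
        have : x ≠ v := by rintro rfl; exact hE.not_mem_nbr x hx
        simp [this]
      rw [Pi.add_apply, Pi.add_apply, Pi.add_apply, this, this, clear_self]; rfl
    · simp [hv]

/-- The factor `q` appears because `removedZ` still sums over the colour of the now isolated vertex
`u`. -/
lemma card_mul_pinnedZ {R : Type*} [CommSemiring R] (w : R) {E : Finset (Sym2 V)}
    (hE : Loopless E) (b : V → Fin q → ℕ) (u : V) :
    (q : R) * pinnedZ w E b = ∑ l, w ^ b u l * removedZ w E b u l := by
  have h : ∀ l : Fin q, w ^ b u l * removedZ w E b u l =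
      ∑ φ : V → Fin q, w ^ cost E b (Function.update φ u l) := by
    intro l
    rw [removedZ, pinnedZ, mul_sum]
    refine sum_congr rfl fun φ _ => ?_
    rw [cost_split E b u, Function.update_self, cost_cut_update hE, pow_add]
  simp_rw [h]
  rw [← Fintype.sum_prod_type' (f := fun (l : Fin q) (φ : V → Fin q) =>
    w ^ cost E b (Function.update φ u l))]
  have hq : (q : R) * pinnedZ w E b = ∑ x : Fin q × (V → Fin q), w ^ cost E b x.2 := by
    rw [Fintype.sum_prod_type]
    simp [pinnedZ]
  rw [hq]
  -- Exchanging the imposed colour `l` with the idle colour `φ u` is an involution matching the two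
  -- sums term by term.
  let σ : Fin q × (V → Fin q) → Fin q × (V → Fin q) := fun x => (x.2 u, Function.update x.2 u x.1)
  have hσ : Function.Involutive σ := by
    rintro ⟨l, φ⟩
    simp [σ]
  refine (Fintype.sum_equiv hσ.toPerm _ _ fun x => ?_).symm
  simp [σ]

lemma card_mul_pinnedZ_add_pin {R : Type*} [CommSemiring R] (w : R) {E : Finset (Sym2 V)}
    (hE : Loopless E) (b : V → Fin q → ℕ) (u : V) (i : Fin q) :
    (q : R) * pinnedZ w E (b + pin u i) =
      ∑ l, w ^ (b u l + if l = i then 1 else 0) * removedZ w E b u l := by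
  rw [card_mul_pinnedZ w hE _ u]
  refine sum_congr rfl fun l _ => ?_
  rw [removedZ_add_pin]
  simp [pin_apply]

lemma nbr_cut_self (E : Finset (Sym2 V)) (u : V) : nbr (cut E u) u = ∅ := by
  ext v; simp [mem_nbr, cut]

lemma nbr_cut_of_ne (E : Finset (Sym2 V)) {u v : V} (h : v ≠ u) :
    nbr (cut E u) v = (nbr E v).erase u := by
  ext x
  simp only [mem_nbr, cut, mem_filter, mem_erase, Sym2.mem_iff, not_or]
  constructor
  · rintro ⟨h1, h2, h3⟩; exact ⟨Ne.symm h3, h1⟩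
  · rintro ⟨h1, h2⟩; exact ⟨h2, Ne.symm h, Ne.symm h1⟩

/-- Removing `u` lowers the load of its neighbours by one; added pins raise it again. -/
lemma load_cut_add {E : Finset (Sym2 V)} (hE : Loopless E) (b c : V → Fin q → ℕ) (u v : V) :
    load (cut E u) (clear b u + c) v + (if v ∈ nbr E u then 1 else 0) ≤
      load E b v + ∑ l, c v l := by
  by_cases h : v = u
  · subst h
    simp [load, nbr_cut_self, clear_self, hE.not_mem_nbr]
  · have hm : v ∈ nbr E u ↔ u ∈ nbr E v := by rw [mem_nbr, mem_nbr, Sym2.eq_swap]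
    simp only [load, nbr_cut_of_ne E h, Pi.add_apply, clear_of_ne b h, sum_add_distrib, hm]
    split_ifs with h2
    · rw [← card_erase_add_one h2]; omega
    · rw [erase_eq_of_notMem h2]; omega

/-! ### Switching the pins of the neighbours one at a time. -/

/-- An enumeration of a finite set. -/
noncomputable def enum (N : Finset V) (d : V) (k : ℕ) : V := N.toList.getD k d

lemma sum_enum {A : Type*} [AddCommMonoid A] (N : Finset V) (d : V) (F : V → A) :
    ∑ k ∈ range N.card, F (enum N d k) = ∑ v ∈ N, F v := by
  rw [← Finset.sum_map_toList N, ← Finset.length_toList N, Finset.sum_range,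
    ← List.sum_ofFn]
  congr 1
  apply List.ext_getElem <;> simp [enum]

lemma enum_mem {N : Finset V} (d : V) {k : ℕ} (hk : k < N.card) : enum N d k ∈ N := by
  rw [← Finset.mem_toList, enum, List.getD_eq_getElem _ _ (by simpa using hk)]
  exact List.getElem_mem _

/-- The pins that the first `k` neighbours of `u` get with colour `i`. -/
noncomputable def headPins (E : Finset (Sym2 V)) (u : V) (i : Fin q) (k : ℕ) : V → Fin q → ℕ :=
  ∑ m ∈ range k, pin (enum (nbr E u) u m) i

/-- The pins that the neighbours of `u` from the `k`-th on get with colour `l`. -/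
noncomputable def tailPins (E : Finset (Sym2 V)) (u : V) (l : Fin q) (k : ℕ) : V → Fin q → ℕ :=
  ∑ m ∈ Ico k (nbr E u).card, pin (enum (nbr E u) u m) l

/-- The pins at the `k`-th step of the passage from colour `l` to colour `i` at `u`, with no pin at
the `k`-th neighbour. -/
noncomputable def stepPins (E : Finset (Sym2 V)) (b : V → Fin q → ℕ) (u : V) (i l : Fin q) (k : ℕ) :
    V → Fin q → ℕ :=
  clear b u + headPins E u i k + tailPins E u l (k + 1)

lemma headPins_succ (E : Finset (Sym2 V)) (u : V) (i : Fin q) (k : ℕ) :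
    headPins E u i (k + 1) = headPins E u i k + pin (enum (nbr E u) u k) i :=
  sum_range_succ _ _

lemma headPins_zero (E : Finset (Sym2 V)) (u : V) (i : Fin q) : headPins E u i 0 = 0 := rfl

lemma headPins_card (E : Finset (Sym2 V)) (u : V) (i : Fin q) :
    headPins E u i (nbr E u).card = ∑ v ∈ nbr E u, pin v i :=
  sum_enum _ _ fun v => pin v i

lemma tailPins_of_lt (E : Finset (Sym2 V)) (u : V) (l : Fin q) {k : ℕ} (hk : k < (nbr E u).card) :
    tailPins E u l k = tailPins E u l (k + 1) + pin (enum (nbr E u) u k) l := by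
  rw [tailPins, sum_eq_sum_Ico_succ_bot hk, add_comm]; rfl

lemma tailPins_card (E : Finset (Sym2 V)) (u : V) (l : Fin q) :
    tailPins E u l (nbr E u).card = 0 := by simp [tailPins]

lemma tailPins_zero (E : Finset (Sym2 V)) (u : V) (l : Fin q) :
    tailPins E u l 0 = ∑ v ∈ nbr E u, pin v l := by
  rw [← headPins_card, tailPins, headPins, range_eq_Ico]

lemma stepPins_add_fst (E : Finset (Sym2 V)) (b : V → Fin q → ℕ) (u : V) (i l : Fin q) (k : ℕ) :
    stepPins E b u i l k + pin (enum (nbr E u) u k) i =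
      clear b u + headPins E u i (k + 1) + tailPins E u l (k + 1) := by
  rw [stepPins, headPins_succ]; abel

lemma stepPins_add_snd (E : Finset (Sym2 V)) (b : V → Fin q → ℕ) (u : V) (i l : Fin q) {k : ℕ}
    (hk : k < (nbr E u).card) :
    stepPins E b u i l k + pin (enum (nbr E u) u k) l =
      clear b u + headPins E u i k + tailPins E u l k := by
  rw [stepPins, tailPins_of_lt E u l hk]; abel

/-- Every neighbour of `u` loses the edge to `u` and receives one pin, except the `k`-th, which
receives none. This leaves room there for the pin being switched. -/
lemma load_stepPins {E : Finset (Sym2 V)} (hE : Loopless E) (b : V → Fin q → ℕ) (u : V)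
    (i l : Fin q) {k : ℕ} (hk : k < (nbr E u).card) (x : V) :
    load (cut E u) (stepPins E b u i l k) x + (if enum (nbr E u) u k = x then 1 else 0) ≤
      load E b x := by
  have h := load_cut_add hE b (headPins E u i k + tailPins E u l (k + 1)) u x
  have h2 : ∑ m, (headPins E u i k + tailPins E u l (k + 1)) x m +
      (if enum (nbr E u) u k = x then 1 else 0) = if x ∈ nbr E u then 1 else 0 := by
    have h3 : ∀ (s : Finset ℕ) (j : Fin q), ∑ m, (∑ y ∈ s, pin (enum (nbr E u) u y) j) x m =
        ∑ y ∈ s, if enum (nbr E u) u y = x then 1 else 0 := by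
      intro s j
      simp only [Finset.sum_apply]
      rw [sum_comm]
      exact sum_congr rfl fun y _ => sum_pin _ _ _
    simp only [Pi.add_apply, sum_add_distrib]
    rw [headPins, tailPins, h3, h3, add_assoc, add_comm (∑ y ∈ Ico _ _, _),
      ← sum_eq_sum_Ico_succ_bot hk (fun y => if enum (nbr E u) u y = x then 1 else 0),
      range_eq_Ico, sum_Ico_consecutive _ (Nat.zero_le _) hk.le, ← range_eq_Ico,
      sum_enum (nbr E u) u fun v => if v = x then 1 else 0]
    simp
  rw [← add_assoc] at h
  change load (cut E u) (stepPins E b u i l k) x + _ ≤ _ at h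
  omega

lemma load_add_pins {E : Finset (Sym2 V)} (hE : Loopless E) (b : V → Fin q → ℕ) (u : V)
    (l : Fin q) (x : V) :
    load (cut E u) (clear b u + ∑ v ∈ nbr E u, pin v l) x ≤ load E b x := by
  have h := load_cut_add hE b (∑ v ∈ nbr E u, pin v l) u x
  have h2 : ∑ m, (∑ v ∈ nbr E u, pin v l) x m = if x ∈ nbr E u then 1 else 0 := by
    simp only [Finset.sum_apply]
    rw [sum_comm, sum_congr rfl fun y _ => sum_pin y x l]
    simp
  omega

/-! ### Real weights: positivity, correlation inequalities and the size of `coef`. -/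

section Real

variable {w : ℝ}

lemma pinnedZ_nonneg (hw : 0 ≤ w) (E : Finset (Sym2 V)) (b : V → Fin q → ℕ) :
    0 ≤ pinnedZ w E b :=
  sum_nonneg fun _ _ => pow_nonneg hw _

lemma pinnedZ_add_le (hw : 0 ≤ w) (hw1 : w ≤ 1) (E : Finset (Sym2 V)) (b c : V → Fin q → ℕ) :
    pinnedZ w E (b + c) ≤ pinnedZ w E b :=
  sum_le_sum fun φ _ => pow_le_pow_of_le_one hw hw1 (by rw [cost_add]; omega)

/-- The partition function is supermodular in the pins. -/
lemma pinnedZ_supermodular (hw : 0 ≤ w) (hw1 : w ≤ 1) (E : Finset (Sym2 V))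
    (b c d : V → Fin q → ℕ) :
    pinnedZ w E (b + c) + pinnedZ w E (b + d) ≤ pinnedZ w E (b + c + d) + pinnedZ w E b := by
  simp only [pinnedZ, ← sum_add_distrib]
  refine sum_le_sum fun φ _ => ?_
  simp only [cost_add, pow_add]
  have h1 := pow_le_one₀ (n := ∑ v, c v (φ v)) hw hw1
  have h2 := pow_le_one₀ (n := ∑ v, d v (φ v)) hw hw1
  -- For each colouring this is `(1 - w ^ c) * (1 - w ^ d) ≥ 0`.
  nlinarith [mul_nonneg (pow_nonneg hw (cost E b φ))
    (mul_nonneg (sub_nonneg.2 h1) (sub_nonneg.2 h2))]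

/-- Greedy colouring: edges and pins at a vertex forbid at most `load < q` colours. This colouring
keeps the partition function positive even at `w = 0`. -/
lemma exists_cost_eq_zero {E : Finset (Sym2 V)} (hE : Loopless E) {b : V → Fin q → ℕ}
    (hb : ∀ v, load E b v < q) : ∃ φ, cost E b φ = 0 := by
  rcases isEmpty_or_nonempty V with hV | ⟨⟨v₀⟩⟩
  · refine ⟨fun v => isEmptyElim v, ?_⟩
    have : E = ∅ := eq_empty_of_forall_notMem fun e => by
      induction e with | _ x y => exact isEmptyElim x
    simp [cost, this]
  have hq : 0 < q := by have := hb v₀; omega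
  have key : ∀ S : Finset V, ∃ φ : V → Fin q, ∀ v ∈ S, b v (φ v) = 0 ∧
      ∀ x ∈ S, s(v, x) ∈ E → φ v ≠ φ x := by
    intro S
    induction S using Finset.induction_on with
    | empty => exact ⟨fun _ => ⟨0, hq⟩, by simp⟩
    | insert u S hu ih =>
      obtain ⟨φ, hφ⟩ := ih
      have hc : ((nbr E u).image φ ∪ univ.filter fun l => b u l ≠ 0).card < q := by
        refine lt_of_le_of_lt (card_union_le _ _) (lt_of_le_of_lt ?_ (hb u))
        refine add_le_add card_image_le ?_
        rw [card_filter]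
        refine sum_le_sum fun l _ => ?_
        split_ifs <;> omega
      obtain ⟨l, hl⟩ : ∃ l, l ∉ (nbr E u).image φ ∪ univ.filter fun l => b u l ≠ 0 := by
        by_contra! h
        rw [eq_univ_of_forall h] at hc
        simp at hc
      simp only [mem_union, mem_image, mem_filter, mem_univ, true_and, not_or, not_exists,
        not_and, not_not, mem_nbr] at hl
      refine ⟨Function.update φ u l, fun v hv => ?_⟩
      rcases mem_insert.1 hv with rfl | hvS
      · refine ⟨by simpa using hl.2, fun x hx hE' => ?_⟩
        rcases mem_insert.1 hx with rfl | hxS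
        · exact absurd hE' (hE _)
        · have hne : x ≠ v := by rintro rfl; exact hu hxS
          simpa [hne] using Ne.symm (hl.1 x hE')
      · have hne : v ≠ u := by rintro rfl; exact hu hvS
        refine ⟨by simpa [hne] using (hφ v hvS).1, fun x hx hE' => ?_⟩
        rcases mem_insert.1 hx with rfl | hxS
        · simpa [hne] using hl.1 v (by rwa [Sym2.eq_swap])
        · have hne' : x ≠ u := by rintro rfl; exact hu hxS
          simpa [hne, hne'] using (hφ v hvS).2 x hxS hE'
  obtain ⟨φ, hφ⟩ := key univ
  refine ⟨φ, ?_⟩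
  have h1 : (E.filter fun e => (Sym2.map φ e).IsDiag) = ∅ := by
    refine filter_eq_empty_iff.2 fun e he => ?_
    induction e with
    | _ x y => simpa using (hφ x (mem_univ _)).2 y (mem_univ _) he
  simp [cost, h1, fun v => (hφ v (mem_univ v)).1]

lemma pinnedZ_pos (hw : 0 ≤ w) {E : Finset (Sym2 V)} (hE : Loopless E) {b : V → Fin q → ℕ}
    (hb : ∀ v, load E b v < q) : 0 < pinnedZ w E b := by
  obtain ⟨φ, hφ⟩ := exists_cost_eq_zero hE hb
  refine lt_of_lt_of_le zero_lt_one ?_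
  calc (1 : ℝ) = w ^ cost E b φ := by rw [hφ, pow_zero]
    _ ≤ _ := single_le_sum (f := fun φ => w ^ cost E b φ) (fun _ _ => pow_nonneg hw _) (mem_univ φ)

lemma load_clear_le {E : Finset (Sym2 V)} (hE : Loopless E) (b : V → Fin q → ℕ) (u x : V) :
    load (cut E u) (clear b u) x ≤ load E b x := by
  have := load_cut_add hE b 0 u x
  simp at this
  omega

/-- Bernoulli's inequality for the colour at a removed vertex. -/
lemma le_sum_pow_mul_removedZ (hw : 0 ≤ w) (E : Finset (Sym2 V))
    (b : V → Fin q → ℕ) (u : V) (β : Fin q → ℕ) :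
    ((q : ℝ) - (1 - w) * (((nbr E u).card : ℝ) + ∑ l, (β l : ℝ))) *
        pinnedZ w (cut E u) (clear b u) ≤ ∑ l, w ^ β l * removedZ w E b u l := by
  simp only [removedZ, pinnedZ, mul_sum]
  rw [sum_comm]
  refine sum_le_sum fun φ _ => ?_
  have h1 : ∀ l : Fin q, w ^ β l * w ^ cost (cut E u) (clear b u + ∑ v ∈ nbr E u, pin v l) φ =
      w ^ (β l + ((nbr E u).filter fun x => φ x = l).card) * w ^ cost (cut E u) (clear b u) φ := by
    intro l
    rw [cost_add, sum_sum_pin]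
    ring
  simp only [h1, ← sum_mul]
  refine mul_le_mul_of_nonneg_right ?_ (pow_nonneg hw _)
  have h2 : ∀ n : ℕ, 1 - (1 - w) * (n : ℝ) ≤ w ^ n := by
    intro n
    have := one_add_mul_le_pow (a := w - 1) (by linarith) n
    rw [show 1 + (w - 1) = w by ring] at this
    linarith
  have h3 : ∑ l : Fin q, ((nbr E u).filter fun x => φ x = l).card = (nbr E u).card :=
    (card_eq_sum_card_fiberwise fun x _ => mem_univ (φ x)).symm
  calc _ = ∑ l : Fin q, (1 - (1 - w) *
        ((β l + ((nbr E u).filter fun x => φ x = l).card : ℕ) : ℝ)) := by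
        rw [sum_sub_distrib, ← mul_sum, ← h3]
        push_cast
        rw [sum_add_distrib, sum_const, card_univ, Fintype.card_fin, nsmul_eq_mul]
        ring
    _ ≤ _ := sum_le_sum fun l _ => h2 _

lemma removedZ_le (hw : 0 ≤ w) (hw1 : w ≤ 1) (E : Finset (Sym2 V)) (b : V → Fin q → ℕ) (u : V)
    (l : Fin q) : removedZ w E b u l ≤ pinnedZ w (cut E u) (clear b u) :=
  pinnedZ_add_le hw hw1 _ _ _

/-- The sensitivity of the logarithm of the probability of avoiding colour `i` at `u`. -/
noncomputable def coef (w : ℝ) (E : Finset (Sym2 V)) (b : V → Fin q → ℕ) (u : V) (i : Fin q) : ℝ :=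
  pinnedZ w E b / pinnedZ w E (b + pin u i) - 1

/-- A loopless graph with pins in which every load is at most `Δ < q`. -/
structure Admissible (Δ : ℕ) (E : Finset (Sym2 V)) (b : V → Fin q → ℕ) : Prop where
  loopless : Loopless E
  load_le : ∀ v, load E b v ≤ Δ
  lt : Δ < q

namespace Admissible

variable {Δ : ℕ} {E : Finset (Sym2 V)} {b : V → Fin q → ℕ}

lemma pos (h : Admissible Δ E b) (hw : 0 ≤ w) : 0 < pinnedZ w E b :=
  pinnedZ_pos hw h.loopless fun v => lt_of_le_of_lt (h.load_le v) h.lt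

lemma clear (h : Admissible Δ E b) (u : V) : Admissible Δ (cut E u) (clear b u) :=
  ⟨h.loopless.cut u, fun v => (load_clear_le h.loopless b u v).trans (h.load_le v), h.lt⟩

lemma removed (h : Admissible Δ E b) (u : V) (l : Fin q) :
    Admissible Δ (cut E u) (PinnedPotts.clear b u + ∑ v ∈ nbr E u, pin v l) :=
  ⟨h.loopless.cut u, fun v => (load_add_pins h.loopless b u l v).trans (h.load_le v), h.lt⟩

lemma removedZ_pos (h : Admissible Δ E b) (hw : 0 ≤ w) (u : V) (l : Fin q) :
    0 < removedZ w E b u l := (h.removed u l).pos hw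

lemma step (h : Admissible Δ E b) (u : V) (i l : Fin q) {k : ℕ} (hk : k < (nbr E u).card) :
    Admissible Δ (cut E u) (stepPins E b u i l k) :=
  ⟨h.loopless.cut u, fun v => by
    have := load_stepPins h.loopless b u i l hk v
    have := h.load_le v
    omega, h.lt⟩

lemma load_step (h : Admissible Δ E b) (u : V) (i l : Fin q) {k : ℕ} (hk : k < (nbr E u).card) :
    load (cut E u) (stepPins E b u i l k) (enum (nbr E u) u k) + 1 ≤ Δ := by
  have h1 := load_stepPins h.loopless b u i l hk (enum (nbr E u) u k)
  have h2 := h.load_le (enum (nbr E u) u k)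
  simp at h1
  omega

lemma addPin (h : Admissible Δ E b) {u : V} (hu : load E b u + 1 ≤ Δ) (i : Fin q) :
    Admissible Δ E (b + pin u i) := by
  refine ⟨h.loopless, fun v => ?_, h.lt⟩
  have h1 := h.load_le v
  have h2 := sum_pin u v i
  simp only [load, Pi.add_apply, sum_add_distrib, h2] at *
  split_ifs with hv
  · subst hv; omega
  · omega

end Admissible

variable {Δ : ℕ} {E : Finset (Sym2 V)} {b : V → Fin q → ℕ}

lemma card_mul_pinnedZ_add_pin_eq (hE : Loopless E) (b : V → Fin q → ℕ) (u : V) (i : Fin q) :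
    (q : ℝ) * pinnedZ w E (b + pin u i) =
      q * pinnedZ w E b - (1 - w) * (w ^ b u i * removedZ w E b u i) := by
  rw [card_mul_pinnedZ_add_pin w hE, card_mul_pinnedZ w hE b u,
    ← add_sum_erase _ _ (mem_univ i), ← add_sum_erase _ (fun l => w ^ b u l * _) (mem_univ i)]
  have : ∑ x ∈ univ.erase i, w ^ (b u x + if x = i then 1 else 0) * removedZ w E b u x =
      ∑ x ∈ univ.erase i, w ^ b u x * removedZ w E b u x :=
    sum_congr rfl fun x hx => by simp [ne_of_mem_erase hx]
  rw [this]
  simp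
  ring

lemma coef_eq (h : Admissible Δ E b) (hw : 0 ≤ w) {u : V}
    (hu : load E b u + 1 ≤ Δ) (i : Fin q) :
    coef w E b u i * (q * pinnedZ w E (b + pin u i)) =
      (1 - w) * (w ^ b u i * removedZ w E b u i) := by
  have hp := (h.addPin hu i).pos hw
  have := card_mul_pinnedZ_add_pin_eq (w := w) h.loopless b u i
  rw [coef]
  field_simp
  linarith

lemma coef_nonneg (h : Admissible Δ E b) (hw : 0 ≤ w) (hw1 : w ≤ 1) {u : V}
    (hu : load E b u + 1 ≤ Δ) (i : Fin q) : 0 ≤ coef w E b u i := by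
  have hp := (h.addPin hu i).pos hw
  rw [coef, sub_nonneg, one_le_div hp]
  exact pinnedZ_add_le hw hw1 _ _ _

lemma le_card_mul_pinnedZ_add_pin (h : Admissible Δ E b) (hw : 0 ≤ w) (hw1 : w ≤ 1) {u : V}
    (hu : load E b u + 1 ≤ Δ) (i : Fin q) :
    ((q : ℝ) - (1 - w) * Δ) * pinnedZ w (cut E u) (clear b u) ≤
      q * pinnedZ w E (b + pin u i) := by
  rw [card_mul_pinnedZ_add_pin w h.loopless]
  refine le_trans (mul_le_mul_of_nonneg_right ?_ (pinnedZ_nonneg hw _ _))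
    (le_sum_pow_mul_removedZ hw E b u _)
  have h2 : ((load E b u + 1 : ℕ) : ℝ) ≤ Δ := by exact_mod_cast hu
  have h3 : ((load E b u + 1 : ℕ) : ℝ) = ((nbr E u).card : ℝ) +
      ∑ l, ((b u l + if l = i then 1 else 0 : ℕ) : ℝ) := by
    rw [← Nat.cast_sum, ← Nat.cast_add, load, sum_add_distrib]
    congr 1
    simp [add_assoc]
  rw [← h3]
  nlinarith

/-- The factor `1 - w` in `coef_eq` is absorbed by `(1 - w) * (q - Δ) ≤ q - (1 - w) * Δ`. Keeping
`removedZ` on the right, instead of bounding it at once, is what later shows that a large `coef`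
forces a large availability. -/
lemma coef_mul_le (h : Admissible Δ E b) (hw : 0 ≤ w) (hw1 : w ≤ 1) {u : V}
    (hu : load E b u + 1 ≤ Δ) (i : Fin q) :
    coef w E b u i * ((q : ℝ) - Δ) * pinnedZ w (cut E u) (clear b u) ≤ removedZ w E b u i := by
  have hp := (h.addPin hu i).pos hw
  have hq : (0 : ℝ) < q := by exact_mod_cast (Nat.zero_le _).trans_lt h.lt
  have hN : (0 : ℝ) < (q : ℝ) - Δ := sub_pos.2 (by exact_mod_cast h.lt)
  have h0 := (h.clear u).pos hw
  have hY := h.removedZ_pos hw u i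
  have h1 := coef_eq h hw hu i
  have h2 := le_card_mul_pinnedZ_add_pin h hw hw1 hu i
  have h3 : w ^ b u i ≤ 1 := pow_le_one₀ hw hw1
  have hS : 0 < (q : ℝ) * pinnedZ w E (b + pin u i) := by positivity
  have h5 : (1 - w) * (((q : ℝ) - Δ) * pinnedZ w (cut E u) (clear b u)) ≤
      q * pinnedZ w E (b + pin u i) := by
    refine le_trans ?_ h2
    nlinarith [mul_nonneg (mul_nonneg hw hq.le) h0.le]
  refine le_of_mul_le_mul_right ?_ hS
  calc _ = (coef w E b u i * (q * pinnedZ w E (b + pin u i))) *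
        (((q : ℝ) - Δ) * pinnedZ w (cut E u) (clear b u)) := by ring
    _ = (w ^ b u i * removedZ w E b u i) *
        ((1 - w) * (((q : ℝ) - Δ) * pinnedZ w (cut E u) (clear b u))) := by rw [h1]; ring
    _ ≤ (1 * removedZ w E b u i) * (q * pinnedZ w E (b + pin u i)) := by
        gcongr
    _ = _ := by ring

lemma coef_le (h : Admissible Δ E b) (hw : 0 ≤ w) (hw1 : w ≤ 1) {u : V}
    (hu : load E b u + 1 ≤ Δ) (i : Fin q) : coef w E b u i ≤ 1 / ((q : ℝ) - Δ) := by
  have hN : (0 : ℝ) < (q : ℝ) - Δ := sub_pos.2 (by exact_mod_cast h.lt)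
  have h0 := (h.clear u).pos hw
  have h1 := (coef_mul_le h hw hw1 hu i).trans (removedZ_le hw hw1 E b u i)
  rw [le_div_iff₀ hN]
  refine le_of_mul_le_mul_right ?_ h0
  linarith

/-! ### Bounding the total cost of a colour switch by availabilities. -/

/-- The bound on the change of the log-ratio of colours `i` and `l` at `u` relative to the changes
one step further. -/
noncomputable def spread (w : ℝ) (E : Finset (Sym2 V)) (b : V → Fin q → ℕ) (u : V) (i l : Fin q) :
    ℝ :=
  ∑ k ∈ range (nbr E u).card,
    max (coef w (cut E u) (stepPins E b u i l k) (enum (nbr E u) u k) i)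
      (coef w (cut E u) (stepPins E b u i l k) (enum (nbr E u) u k) l)

/-- `1 - 1 / (1 + coef)`, the complement of the probability of avoiding colour `i` at `u`. -/
noncomputable def drop (w : ℝ) (E : Finset (Sym2 V)) (b : V → Fin q → ℕ) (u : V) (i : Fin q) : ℝ :=
  1 - pinnedZ w E (b + pin u i) / pinnedZ w E b

lemma drop_nonneg (h : Admissible Δ E b) (hw : 0 ≤ w) (hw1 : w ≤ 1) (u : V) (i : Fin q) :
    0 ≤ drop w E b u i := by
  rw [drop, sub_nonneg, div_le_one (h.pos hw)]
  exact pinnedZ_add_le hw hw1 _ _ _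

lemma coef_le_drop (h : Admissible Δ E b) (hw : 0 ≤ w) (hw1 : w ≤ 1) {u : V}
    (hu : load E b u + 1 ≤ Δ) (i : Fin q) :
    coef w E b u i ≤ (1 + 1 / ((q : ℝ) - Δ)) * drop w E b u i := by
  have h1 : coef w E b u i = (1 + coef w E b u i) * drop w E b u i := by
    have := (h.addPin hu i).pos hw
    have := h.pos hw
    rw [coef, drop]
    field_simp
    ring
  rw [h1]
  exact mul_le_mul_of_nonneg_right (by linarith [coef_le h hw hw1 hu i])
    (drop_nonneg h hw hw1 u i)

/-- A union bound: by supermodularity the head and tail pins together cost at most the sum of their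
separate costs, and each is cheaper than pinning all neighbours. -/
lemma le_pinnedZ_stepPins (hw : 0 ≤ w) (hw1 : w ≤ 1) (u : V)
    (i l : Fin q) {κ : ℝ}
    (hZ : κ * pinnedZ w (cut E u) (clear b u) ≤ removedZ w E b u i + removedZ w E b u l -
      pinnedZ w (cut E u) (clear b u)) {k : ℕ} (hk : k < (nbr E u).card) :
    κ * pinnedZ w (cut E u) (clear b u) ≤ pinnedZ w (cut E u) (stepPins E b u i l k) := by
  have h1 := pinnedZ_supermodular hw hw1 (cut E u) (clear b u) (headPins E u i k)
    (tailPins E u l (k + 1))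
  have h2 : removedZ w E b u i ≤ pinnedZ w (cut E u) (clear b u + headPins E u i k) := by
    rw [removedZ, ← headPins_card, headPins, ← sum_range_add_sum_Ico _ hk.le, ← add_assoc]
    exact pinnedZ_add_le hw hw1 _ _ _
  have h3 : removedZ w E b u l ≤ pinnedZ w (cut E u) (clear b u + tailPins E u l (k + 1)) := by
    rw [removedZ, ← tailPins_zero, tailPins, ← range_eq_Ico,
      ← sum_range_add_sum_Ico _ (Nat.succ_le_of_lt hk), add_comm (∑ m ∈ range _, _), ← add_assoc]
    exact pinnedZ_add_le hw hw1 _ _ _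
  rw [stepPins]
  linarith

/-- By supermodularity the tail pins can only decrease the loss caused by one more pin of colour
`i`. Without them the losses telescope; `κ` accounts for the different normalisations. -/
lemma sum_drop_fst_le (h : Admissible Δ E b) (hw : 0 ≤ w) (hw1 : w ≤ 1) (u : V)
    (i l : Fin q) {κ : ℝ} (hκ : 0 < κ)
    (hZ : κ * pinnedZ w (cut E u) (clear b u) ≤ removedZ w E b u i + removedZ w E b u l -
      pinnedZ w (cut E u) (clear b u)) :
    ∑ k ∈ range (nbr E u).card, drop w (cut E u) (stepPins E b u i l k) (enum (nbr E u) u k) i ≤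
      (1 - removedZ w E b u i / pinnedZ w (cut E u) (clear b u)) / κ := by
  have h0 := (h.clear u).pos hw
  set F : ℕ → ℝ := fun k => pinnedZ w (cut E u) (clear b u + headPins E u i k) with hF
  have key : ∀ k ∈ range (nbr E u).card,
      drop w (cut E u) (stepPins E b u i l k) (enum (nbr E u) u k) i ≤
        (F k - F (k + 1)) / (κ * pinnedZ w (cut E u) (clear b u)) := by
    intro k hk
    have hk := mem_range.1 hk
    have hA := (h.step u i l hk).pos hw
    have h1 := le_pinnedZ_stepPins hw hw1 u i l hZ hk
    have h2 := pinnedZ_supermodular hw hw1 (cut E u) (clear b u + headPins E u i k)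
      (pin (enum (nbr E u) u k) i) (tailPins E u l (k + 1))
    have h3 := drop_nonneg (h.step u i l hk) hw hw1 (enum (nbr E u) u k) i
    have h4 : drop w (cut E u) (stepPins E b u i l k) (enum (nbr E u) u k) i *
        pinnedZ w (cut E u) (stepPins E b u i l k) ≤ F k - F (k + 1) := by
      rw [drop, sub_mul, div_mul_cancel₀ _ hA.ne', stepPins_add_fst, hF]
      simp only [headPins_succ, ← add_assoc]
      rw [stepPins]
      linarith
    rw [le_div_iff₀ (by positivity)]
    exact (mul_le_mul_of_nonneg_left h1 h3).trans h4
  refine (sum_le_sum key).trans (le_of_eq ?_)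
  rw [← sum_div, sum_range_sub', hF]
  simp only [headPins_zero, add_zero, headPins_card]
  rw [← removedZ]
  field_simp

/-- The mirror image: the head pins are discarded and the tail telescopes. -/
lemma sum_drop_snd_le (h : Admissible Δ E b) (hw : 0 ≤ w) (hw1 : w ≤ 1) (u : V)
    (i l : Fin q) {κ : ℝ} (hκ : 0 < κ)
    (hZ : κ * pinnedZ w (cut E u) (clear b u) ≤ removedZ w E b u i + removedZ w E b u l -
      pinnedZ w (cut E u) (clear b u)) :
    ∑ k ∈ range (nbr E u).card, drop w (cut E u) (stepPins E b u i l k) (enum (nbr E u) u k) l ≤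
      (1 - removedZ w E b u l / pinnedZ w (cut E u) (clear b u)) / κ := by
  have h0 := (h.clear u).pos hw
  set F : ℕ → ℝ := fun k => pinnedZ w (cut E u) (clear b u + tailPins E u l k) with hF
  have key : ∀ k ∈ range (nbr E u).card,
      drop w (cut E u) (stepPins E b u i l k) (enum (nbr E u) u k) l ≤
        (F (k + 1) - F k) / (κ * pinnedZ w (cut E u) (clear b u)) := by
    intro k hk
    have hk := mem_range.1 hk
    have hA := (h.step u i l hk).pos hw
    have h1 := le_pinnedZ_stepPins hw hw1 u i l hZ hk
    have h2 := pinnedZ_supermodular hw hw1 (cut E u) (clear b u + tailPins E u l (k + 1))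
      (pin (enum (nbr E u) u k) l) (headPins E u i k)
    have h3 := drop_nonneg (h.step u i l hk) hw hw1 (enum (nbr E u) u k) l
    have h4 : drop w (cut E u) (stepPins E b u i l k) (enum (nbr E u) u k) l *
        pinnedZ w (cut E u) (stepPins E b u i l k) ≤ F (k + 1) - F k := by
      rw [drop, sub_mul, div_mul_cancel₀ _ hA.ne', hF]
      simp only [tailPins_of_lt E u l hk, ← add_assoc]
      rw [stepPins, add_right_comm (clear b u) (headPins E u i k),
        add_right_comm _ (headPins E u i k) (pin _ _)]
      linarith
    rw [le_div_iff₀ (by positivity)]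
    exact (mul_le_mul_of_nonneg_left h1 h3).trans h4
  refine (sum_le_sum key).trans (le_of_eq ?_)
  rw [← sum_div, sum_range_sub, hF]
  simp only [tailPins_card, add_zero, tailPins_zero]
  rw [← removedZ]
  field_simp

/-- Here `1 - x ≤ -log x` makes the mixed partition functions telescope exactly. The factor `1 / κ`
then falls only on the losses of colour `i`, which are tiny when `i` is almost surely available. -/
lemma sum_drop_snd_le_log (h : Admissible Δ E b) (hw : 0 ≤ w) (hw1 : w ≤ 1) (u : V)
    (i l : Fin q) {κ : ℝ} (hκ : 0 < κ)
    (hZ : κ * pinnedZ w (cut E u) (clear b u) ≤ removedZ w E b u i + removedZ w E b u l -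
      pinnedZ w (cut E u) (clear b u)) :
    ∑ k ∈ range (nbr E u).card, drop w (cut E u) (stepPins E b u i l k) (enum (nbr E u) u k) l ≤
      Real.log (removedZ w E b u i) - Real.log (removedZ w E b u l) +
        (1 + 1 / ((q : ℝ) - Δ)) *
          ((1 - removedZ w E b u i / pinnedZ w (cut E u) (clear b u)) / κ) := by
  set F : ℕ → ℝ := fun k =>
    Real.log (pinnedZ w (cut E u) (clear b u + headPins E u i k + tailPins E u l k)) with hF
  have hN : (0 : ℝ) < (q : ℝ) - Δ := sub_pos.2 (by exact_mod_cast h.lt)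
  have key : ∀ k ∈ range (nbr E u).card,
      drop w (cut E u) (stepPins E b u i l k) (enum (nbr E u) u k) l ≤
        (F (k + 1) - F k) + (1 + 1 / ((q : ℝ) - Δ)) *
          drop w (cut E u) (stepPins E b u i l k) (enum (nbr E u) u k) i := by
    intro k hk
    have hk := mem_range.1 hk
    have hA := h.step u i l hk
    have hl := h.load_step u i l hk
    have pA := hA.pos hw
    have pi := (hA.addPin hl i).pos hw
    have pl := (hA.addPin hl l).pos hw
    have hi : F (k + 1) = Real.log (pinnedZ w (cut E u)
        (stepPins E b u i l k + pin (enum (nbr E u) u k) i)) := by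
      rw [stepPins_add_fst]
    have hl' : F k = Real.log (pinnedZ w (cut E u)
        (stepPins E b u i l k + pin (enum (nbr E u) u k) l)) := by
      rw [stepPins_add_snd E b u i l hk]
    have h1 := coef_le_drop hA hw hw1 hl i
    have h2 := Real.log_le_sub_one_of_pos (div_pos pl pA)
    have h3 := Real.log_le_sub_one_of_pos (div_pos pA pi)
    rw [Real.log_div pl.ne' pA.ne'] at h2
    rw [Real.log_div pA.ne' pi.ne'] at h3
    rw [hi, hl']
    have h4 : drop w (cut E u) (stepPins E b u i l k) (enum (nbr E u) u k) l =
      1 - pinnedZ w (cut E u) (stepPins E b u i l k + pin (enum (nbr E u) u k) l) /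
        pinnedZ w (cut E u) (stepPins E b u i l k) := rfl
    have h5 : coef w (cut E u) (stepPins E b u i l k) (enum (nbr E u) u k) i =
      pinnedZ w (cut E u) (stepPins E b u i l k) /
        pinnedZ w (cut E u) (stepPins E b u i l k + pin (enum (nbr E u) u k) i) - 1 := rfl
    linarith
  refine (sum_le_sum key).trans ?_
  rw [sum_add_distrib, sum_range_sub, ← mul_sum, hF]
  simp only [tailPins_card, add_zero, tailPins_zero, headPins_zero, headPins_card]
  rw [← removedZ, ← removedZ]
  gcongr
  exact sum_drop_fst_le h hw hw1 u i l hκ hZ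

lemma spread_le_sum_drop (h : Admissible Δ E b) (hw : 0 ≤ w) (hw1 : w ≤ 1) (u : V)
    (i l : Fin q) :
    spread w E b u i l ≤ (1 + 1 / ((q : ℝ) - Δ)) *
      (∑ k ∈ range (nbr E u).card,
        drop w (cut E u) (stepPins E b u i l k) (enum (nbr E u) u k) i +
      ∑ k ∈ range (nbr E u).card,
        drop w (cut E u) (stepPins E b u i l k) (enum (nbr E u) u k) l) := by
  have hN : (0 : ℝ) < (q : ℝ) - Δ := sub_pos.2 (by exact_mod_cast h.lt)
  rw [← sum_add_distrib, mul_sum]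
  refine sum_le_sum fun k hk => ?_
  have hk := mem_range.1 hk
  have hA := h.step u i l hk
  have hl := h.load_step u i l hk
  rw [mul_add]
  have hc : 0 ≤ 1 + 1 / ((q : ℝ) - Δ) := by positivity
  exact max_le (le_add_of_le_of_nonneg (coef_le_drop hA hw hw1 hl _)
      (mul_nonneg hc (drop_nonneg hA hw hw1 _ _)))
    (le_add_of_nonneg_of_le (mul_nonneg hc (drop_nonneg hA hw hw1 _ _))
      (coef_le_drop hA hw hw1 hl _))

end Real

/-! ### Contraction of the linear part. -/

section Contraction

variable {w : ℝ} {Δ : ℕ} {E : Finset (Sym2 V)} {b : V → Fin q → ℕ}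

/-- The mean of `δ` with respect to the distribution of the colour of `u`. -/
noncomputable def mean (w : ℝ) (E : Finset (Sym2 V)) (b : V → Fin q → ℕ) (u : V) (δ : Fin q → ℂ) :
    ℂ :=
  ∑ l, ((w ^ b u l * removedZ w E b u l / (q * pinnedZ w E b) : ℝ) : ℂ) * δ l

lemma norm_mean_sub_le (h : Admissible Δ E b) (hw : 0 ≤ w) (u : V) (δ : Fin q → ℂ) (i : Fin q)
    {B : Fin q → ℝ} (hB : ∀ l, ‖δ i - δ l‖ ≤ B l) :
    ‖mean w E b u δ - δ i‖ ≤
      (∑ l, w ^ b u l * removedZ w E b u l * B l) / (q * pinnedZ w E b) := by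
  have hq : (0 : ℝ) < q := by exact_mod_cast (Nat.zero_le _).trans_lt h.lt
  have hZ := h.pos hw
  have h1 : ∑ l, ((w ^ b u l * removedZ w E b u l / (q * pinnedZ w E b) : ℝ) : ℂ) = 1 := by
    rw [← Complex.ofReal_sum, ← sum_div, ← card_mul_pinnedZ w h.loopless, div_self (by positivity),
      Complex.ofReal_one]
  have h2 : mean w E b u δ - δ i =
      ∑ l, ((w ^ b u l * removedZ w E b u l / (q * pinnedZ w E b) : ℝ) : ℂ) * (δ l - δ i) := by
    simp_rw [mul_sub, sum_sub_distrib, ← sum_mul]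
    rw [h1, one_mul, mean]
  rw [h2, sum_div]
  refine (norm_sum_le _ _).trans (sum_le_sum fun l _ => ?_)
  have hY := h.removedZ_pos hw u l
  have h3 : 0 ≤ w ^ b u l * removedZ w E b u l / (q * pinnedZ w E b) := by positivity
  rw [norm_mul, Complex.norm_real, Real.norm_of_nonneg h3, norm_sub_rev,
    mul_div_right_comm (w ^ b u l * removedZ w E b u l)]
  exact mul_le_mul_of_nonneg_left (hB l) h3

lemma norm_mean_sub_le_const (h : Admissible Δ E b) (hw : 0 ≤ w) (u : V) (δ : Fin q → ℂ)
    (i : Fin q) {M : ℝ} (hB : ∀ l, ‖δ i - δ l‖ ≤ M) : ‖mean w E b u δ - δ i‖ ≤ M := by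
  have hq : (0 : ℝ) < q := by exact_mod_cast (Nat.zero_le _).trans_lt h.lt
  have hZ := h.pos hw
  refine (norm_mean_sub_le h hw u δ i hB).trans (le_of_eq ?_)
  rw [← sum_mul, ← card_mul_pinnedZ w h.loopless]
  field_simp

/-- The first order change of the log-ratio of the partition functions with a pin of colour `i`,
respectively `j`, at `u`. -/
noncomputable def linearPart (w : ℝ) (E : Finset (Sym2 V)) (b : V → Fin q → ℕ) (u : V)
    (δ : Fin q → ℂ) (i j : Fin q) : ℂ :=
  (coef w E b u i : ℂ) * (mean w E b u δ - δ i) - (coef w E b u j : ℂ) * (mean w E b u δ - δ j)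

lemma linearPart_swap (w : ℝ) (E : Finset (Sym2 V)) (b : V → Fin q → ℕ) (u : V)
    (δ : Fin q → ℂ) (i j : Fin q) : linearPart w E b u δ j i = -linearPart w E b u δ i j := by
  simp [linearPart]

/-- Rewriting with the smaller coefficient in front of `δ j - δ i` leaves nonnegative weights that
sum to the larger coefficient only. -/
lemma norm_linearPart_le_of_coef_le (h : Admissible Δ E b) (hw : 0 ≤ w) (hw1 : w ≤ 1) {u : V}
    (hu : load E b u + 1 ≤ Δ) (δ : Fin q → ℂ) {i j : Fin q}
    (hij : coef w E b u j ≤ coef w E b u i) {D₁ D₂ : ℝ} (h1 : ‖δ i - δ j‖ ≤ D₁)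
    (h2 : ‖mean w E b u δ - δ i‖ ≤ D₂) :
    ‖linearPart w E b u δ i j‖ ≤ coef w E b u j * D₁ + (coef w E b u i - coef w E b u j) * D₂ := by
  have h3 : linearPart w E b u δ i j = (coef w E b u j : ℂ) * (δ j - δ i) +
      ((coef w E b u i - coef w E b u j : ℝ) : ℂ) * (mean w E b u δ - δ i) := by
    rw [linearPart]; push_cast; ring
  rw [h3]
  refine (norm_add_le _ _).trans ?_
  rw [norm_mul, norm_mul, Complex.norm_real, Complex.norm_real,
    Real.norm_of_nonneg (coef_nonneg h hw hw1 hu j), Real.norm_of_nonneg (sub_nonneg.2 hij),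
    norm_sub_rev]
  exact add_le_add (mul_le_mul_of_nonneg_left h1 (coef_nonneg h hw hw1 hu j))
    (mul_le_mul_of_nonneg_left h2 (sub_nonneg.2 hij))

lemma norm_linearPart_le_max (h : Admissible Δ E b) (hw : 0 ≤ w) (hw1 : w ≤ 1) {u : V}
    (hu : load E b u + 1 ≤ Δ) (δ : Fin q → ℂ) {M : ℝ} (hM : ∀ m l, ‖δ m - δ l‖ ≤ M)
    (i j : Fin q) :
    ‖linearPart w E b u δ i j‖ ≤ max (coef w E b u i) (coef w E b u j) * M := by
  rcases le_total (coef w E b u j) (coef w E b u i) with hij | hij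
  · rw [max_eq_left hij]
    refine (norm_linearPart_le_of_coef_le h hw hw1 hu δ hij (hM i j)
      (norm_mean_sub_le_const h hw u δ i (hM i))).trans (le_of_eq (by ring))
  · rw [max_eq_right hij, linearPart_swap, norm_neg]
    refine (norm_linearPart_le_of_coef_le h hw hw1 hu δ hij (hM j i)
      (norm_mean_sub_le_const h hw u δ j (hM j))).trans (le_of_eq (by ring))

/-- The probability, after removal of `u`, that colour `l` is available for `u`. -/
noncomputable def avail (w : ℝ) (E : Finset (Sym2 V)) (b : V → Fin q → ℕ) (u : V) (l : Fin q) : ℝ :=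
  removedZ w E b u l / pinnedZ w (cut E u) (clear b u)

lemma avail_pos (h : Admissible Δ E b) (hw : 0 ≤ w) (u : V) (l : Fin q) : 0 < avail w E b u l :=
  div_pos (h.removedZ_pos hw u l) ((h.clear u).pos hw)

lemma avail_le_one (h : Admissible Δ E b) (hw : 0 ≤ w) (hw1 : w ≤ 1) (u : V) (l : Fin q) :
    avail w E b u l ≤ 1 :=
  (div_le_one ((h.clear u).pos hw)).2 (removedZ_le hw hw1 E b u l)

lemma le_sum_avail (h : Admissible Δ E b) (hw : 0 ≤ w) (u : V) :
    (q : ℝ) - (nbr E u).card ≤ ∑ l, avail w E b u l := by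
  have h1 := le_sum_pow_mul_removedZ hw E b u 0
  have h0 := (h.clear u).pos hw
  simp only [avail, ← sum_div]
  rw [le_div_iff₀ h0]
  simp only [Pi.zero_apply, Nat.cast_zero, sum_const_zero, add_zero, pow_zero, one_mul] at h1
  refine le_trans (mul_le_mul_of_nonneg_right ?_ h0.le) h1
  nlinarith [mul_nonneg hw (Nat.cast_nonneg (α := ℝ) (nbr E u).card)]

lemma coef_le_avail (h : Admissible Δ E b) (hw : 0 ≤ w) (hw1 : w ≤ 1) {u : V}
    (hu : load E b u + 1 ≤ Δ) (i : Fin q) :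
    coef w E b u i ≤ avail w E b u i / ((q : ℝ) - Δ) := by
  have hN : (0 : ℝ) < (q : ℝ) - Δ := sub_pos.2 (by exact_mod_cast h.lt)
  rw [avail, le_div_iff₀ hN, le_div_iff₀ ((h.clear u).pos hw)]
  exact coef_mul_le h hw hw1 hu i

lemma mul_pinnedZ_le_of_avail (h : Admissible Δ E b) (hw : 0 ≤ w) (u : V)
    (i l : Fin q) {κ : ℝ} (hκ : κ ≤ avail w E b u i + avail w E b u l - 1) :
    κ * pinnedZ w (cut E u) (clear b u) ≤ removedZ w E b u i + removedZ w E b u l -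
      pinnedZ w (cut E u) (clear b u) := by
  have h0 := (h.clear u).pos hw
  have h1 := mul_le_mul_of_nonneg_right hκ h0.le
  rw [sub_mul, add_mul, avail, avail, div_mul_cancel₀ _ h0.ne', div_mul_cancel₀ _ h0.ne'] at h1
  linarith

/-- The constant `κ = 0.74` is `0.99 + 0.75 - 1`. -/
lemma spread_le_of_avail (h : Admissible Δ E b) (hw : 0 ≤ w) (hw1 : w ≤ 1)
    (hN : 499 ≤ (q : ℝ) - Δ) (u : V) (i l : Fin q) (hi : 0.99 ≤ avail w E b u i)
    (hl : 0.75 ≤ avail w E b u l) : spread w E b u i l ≤ 0.95 := by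
  have hZ := mul_pinnedZ_le_of_avail h hw u i l (κ := 0.74) (by linarith)
  have h1 := sum_drop_fst_le h hw hw1 u i l (by norm_num) hZ
  have h2 := sum_drop_snd_le h hw hw1 u i l (by norm_num) hZ
  rw [← avail] at h1 h2
  have hN' : 1 / ((q : ℝ) - Δ) ≤ 1 / 499 := one_div_le_one_div_of_le (by norm_num) hN
  have h3 := spread_le_sum_drop h hw hw1 u i l
  refine h3.trans ?_
  have h4 : (1 - avail w E b u i) / 0.74 ≤ 0.014 := by
    rw [div_le_iff₀ (by norm_num)]; linarith
  have h5 : (1 - avail w E b u l) / 0.74 ≤ 0.34 := by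
    rw [div_le_iff₀ (by norm_num)]; linarith
  have hN0 : 0 ≤ 1 / ((q : ℝ) - Δ) := by
    apply one_div_nonneg.2; linarith
  refine (mul_le_mul_of_nonneg_left (b := _) (c := 0.354) ?_ (by linarith)).trans ?_
  · exact (add_le_add (h1.trans h4) (h2.trans h5)).trans (by norm_num)
  · nlinarith

/-- Here `κ = 0.38 = 0.99 + 0.39 - 1`, and `0.053` covers roughly `2 * 0.01 / 0.38`, the two
contributions of colour `i`. -/
lemma spread_le_log (h : Admissible Δ E b) (hw : 0 ≤ w) (hw1 : w ≤ 1)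
    (hN : 499 ≤ (q : ℝ) - Δ) (u : V) (i l : Fin q) (hi : 0.99 ≤ avail w E b u i)
    (hl : 0.39 ≤ avail w E b u l) :
    spread w E b u i l ≤ 1.003 * (0.053 - Real.log (avail w E b u l)) := by
  have hZ := mul_pinnedZ_le_of_avail h hw u i l (κ := 0.38) (by linarith)
  have h0 := (h.clear u).pos hw
  have h1 := sum_drop_fst_le h hw hw1 u i l (by norm_num) hZ
  have h2 := sum_drop_snd_le_log h hw hw1 u i l (by norm_num) hZ
  rw [← avail] at h1 h2
  have hN' : 1 / ((q : ℝ) - Δ) ≤ 1 / 499 := one_div_le_one_div_of_le (by norm_num) hN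
  have hN0 : 0 ≤ 1 / ((q : ℝ) - Δ) := by
    apply one_div_nonneg.2; linarith
  have h3 := spread_le_sum_drop h hw hw1 u i l
  refine h3.trans ?_
  have h4 : (1 - avail w E b u i) / 0.38 ≤ 0.01 / 0.38 := by
    gcongr; linarith
  have h4' : 0 ≤ (1 - avail w E b u i) / 0.38 :=
    div_nonneg (by linarith [avail_le_one h hw hw1 u i]) (by norm_num)
  have hlog : Real.log (removedZ w E b u i) - Real.log (removedZ w E b u l) ≤
      - Real.log (avail w E b u l) := by
    rw [avail, Real.log_div (h.removedZ_pos hw u l).ne' h0.ne']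
    linarith [Real.log_le_log (h.removedZ_pos hw u i) (removedZ_le hw hw1 E b u i)]
  have h5 : (1 + 1 / ((q : ℝ) - Δ)) * ((1 - avail w E b u i) / 0.38) ≤
      (1 + 1 / 499) * (0.01 / 0.38) := by gcongr
  have h6 : Real.log (avail w E b u l) ≤ 0 :=
    Real.log_nonpos (avail_pos h hw u l).le (avail_le_one h hw hw1 u l)
  refine (mul_le_mul_of_nonneg_left (c := 0.053 - Real.log (avail w E b u l)) ?_
    (by linarith)).trans ?_
  · have := add_le_add (h1.trans h4) (h2.trans (add_le_add hlog h5))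
    refine this.trans ?_
    norm_num
    linarith
  · exact mul_le_mul_of_nonneg_right (by linarith) (by linarith)

/-- The tangent of the convex function `s * log s` at `s = 1 / 2`, whose slope is `1 - log 2`. -/
lemma mul_log_tangent {s : ℝ} (hs : 0 < s) : 0.3068 * s - 0.5 ≤ s * Real.log s := by
  have h1 := Real.one_sub_inv_le_log_of_pos (show (0 : ℝ) < 2 * s by linarith)
  rw [Real.log_mul (by norm_num) hs.ne'] at h1
  have h2 := Real.log_two_lt_d9
  have h3 : s * (1 - (2 * s)⁻¹) ≤ s * (Real.log 2 + Real.log s) :=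
    mul_le_mul_of_nonneg_left h1 hs.le
  have h4 : s * (1 - (2 * s)⁻¹) = s - 1 / 2 := by field_simp
  nlinarith

/-- A lower bound linear in the availability, so that it can be summed over the colours knowing only
the sum of the availabilities and the number of pins. -/
lemma avail_mul_min_spread_le (h : Admissible Δ E b) (hw : 0 ≤ w) (hw1 : w ≤ 1)
    (hN : 499 ≤ (q : ℝ) - Δ) (u : V) (i l : Fin q) (hi : 0.99 ≤ avail w E b u i) :
    1.2 * avail w E b u l - 0.5015 - 0.75 * b u l ≤
      w ^ b u l * avail w E b u l * (0.95 - min 1 (spread w E b u i l)) := by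
  have hs := avail_pos h hw u l
  have hs1 := avail_le_one h hw hw1 u l
  have hmin : min 1 (spread w E b u i l) ≤ 1 := min_le_left _ _
  rcases Nat.eq_zero_or_pos (b u l) with hb | hb
  · rw [hb]
    simp only [Nat.cast_zero, mul_zero, sub_zero, pow_zero, one_mul]
    rcases le_or_gt 0.39 (avail w E b u l) with hl | hl
    · have h1 := (min_le_right 1 _).trans (spread_le_log h hw hw1 hN u i l hi hl)
      have h2 := mul_log_tangent hs
      nlinarith [mul_le_mul_of_nonneg_left h1 hs.le]
    -- Below `0.39` truncation at `1` suffices, as `1.2 * s - 0.5015 ≤ -0.05 * s`.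
    · nlinarith
  · have hb' : (1 : ℝ) ≤ b u l := by exact_mod_cast hb
    have h1 : 0 ≤ w ^ b u l * avail w E b u l := by positivity
    have h2 : w ^ b u l * avail w E b u l ≤ 1 :=
      mul_le_one₀ (pow_le_one₀ hw hw1) hs.le hs1
    -- A pinned colour contributes at least `-0.05`, while `1.2 - 0.5015 - 0.75 < -0.05`.
    nlinarith

lemma sum_mul_min_spread_le (h : Admissible Δ E b) (hw : 0 ≤ w) (hw1 : w ≤ 1)
    (hN : 499 ≤ (q : ℝ) - Δ) (hq : 1.998 * (Δ : ℝ) ≤ q) {u : V} (hu : load E b u + 1 ≤ Δ)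
    (i : Fin q) (hi : 0.99 ≤ avail w E b u i) :
    ∑ l, w ^ b u l * removedZ w E b u l * min 1 (spread w E b u i l) ≤
      0.95 * (q * pinnedZ w E b) := by
  have h0 := (h.clear u).pos hw
  have h1 := sum_le_sum fun l (_ : l ∈ univ) => avail_mul_min_spread_le h hw hw1 hN u i l hi
  have h2 := le_sum_avail h hw u
  have h3 : ((nbr E u).card : ℝ) + ∑ l, (b u l : ℝ) ≤ Δ := by
    have : ((load E b u : ℕ) : ℝ) ≤ Δ := by exact_mod_cast (Nat.le_succ _).trans hu
    simpa [load] using this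
  have h4 : 0 ≤ ∑ l, w ^ b u l * avail w E b u l * (0.95 - min 1 (spread w E b u i l)) := by
    refine le_trans ?_ h1
    rw [sum_sub_distrib, sum_sub_distrib, ← mul_sum, ← mul_sum]
    simp only [sum_const, card_univ, Fintype.card_fin, nsmul_eq_mul]
    have h6 : (0 : ℝ) ≤ ∑ l, (b u l : ℝ) := sum_nonneg fun l _ => Nat.cast_nonneg _
    -- The sum is at least `0.6985 * q - 1.2 * Δ`, and `0.6985 * 1.998 > 1.2`.
    linarith [Nat.cast_nonneg (α := ℝ) Δ]
  have h5 : ∑ l, w ^ b u l * avail w E b u l * (0.95 - min 1 (spread w E b u i l)) =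
      (0.95 * (q * pinnedZ w E b) -
        ∑ l, w ^ b u l * removedZ w E b u l * min 1 (spread w E b u i l)) /
        pinnedZ w (cut E u) (clear b u) := by
    rw [card_mul_pinnedZ w h.loopless b u, mul_sum, ← sum_sub_distrib, sum_div]
    refine sum_congr rfl fun l _ => ?_
    rw [avail]
    field_simp
  rw [h5] at h4
  have := (div_nonneg_iff.1 h4).resolve_right fun h => absurd h.2 (not_le.2 h0)
  linarith [this.1]

/-- Below `2Δ` colours the linear part still contracts. -/
lemma norm_linearPart_mul_le (h : Admissible Δ E b) (hw : 0 ≤ w) (hw1 : w ≤ 1)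
    (hN : 499 ≤ (q : ℝ) - Δ) (hq : 1.998 * (Δ : ℝ) ≤ q) {u : V} (hu : load E b u + 1 ≤ Δ)
    (δ : Fin q → ℂ) {M ε : ℝ} (hε : 0 ≤ ε) (hM : ∀ m l, ‖δ m - δ l‖ ≤ M)
    (hX : ∀ m l, ‖δ m - δ l‖ ≤ M * spread w E b u m l + ε) (i j : Fin q) :
    ‖linearPart w E b u δ i j‖ * ((q : ℝ) - Δ) ≤ 0.993 * M + ε := by
  wlog hij : coef w E b u j ≤ coef w E b u i generalizing i j
  · rw [linearPart_swap, norm_neg]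
    exact this j i (le_of_not_ge hij)
  have hN0 : (0 : ℝ) < (q : ℝ) - Δ := by linarith
  have hM0 : 0 ≤ M := (norm_nonneg _).trans (hM i i)
  set N : ℝ := (q : ℝ) - Δ with hNdef
  have ai0 := coef_nonneg h hw hw1 hu i
  have aj0 := coef_nonneg h hw hw1 hu j
  have ai : coef w E b u i * N ≤ avail w E b u i :=
    (le_div_iff₀ hN0).1 (coef_le_avail h hw hw1 hu i)
  have aj : coef w E b u j * N ≤ avail w E b u j :=
    (le_div_iff₀ hN0).1 (coef_le_avail h hw hw1 hu j)
  have si := avail_le_one h hw hw1 u i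
  have hMε : ∀ m l, ‖δ m - δ l‖ ≤ M * min 1 (spread w E b u m l) + ε := by
    intro m l
    rcases min_choice 1 (spread w E b u m l) with h' | h' <;> rw [h']
    · linarith [hM m l]
    · exact hX m l
  -- Either the larger coefficient is away from its maximum `1 / N`, or colour `i` is available with
  -- weight at least `0.99`.
  rcases le_or_gt (coef w E b u i * N) 0.99 with hc | hc
  · have h1 := norm_linearPart_le_max h hw hw1 hu δ hM i j
    rw [max_eq_left hij] at h1
    nlinarith [mul_le_mul_of_nonneg_right h1 hN0.le, mul_le_mul_of_nonneg_right hc hM0]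
  have hi : 0.99 ≤ avail w E b u i := by linarith
  have hmean : ‖mean w E b u δ - δ i‖ ≤ 0.95 * M + ε := by
    refine (norm_mean_sub_le h hw u δ i (hMε i)).trans ?_
    have hqZ : 0 < (q : ℝ) * pinnedZ w E b := by
      have := h.pos hw
      have : (0 : ℝ) < q := by exact_mod_cast (Nat.zero_le _).trans_lt h.lt
      positivity
    rw [div_le_iff₀ hqZ]
    have h1 := sum_mul_min_spread_le h hw hw1 hN hq hu i hi
    have h2 : ∑ l, w ^ b u l * removedZ w E b u l * (M * min 1 (spread w E b u i l) + ε) =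
        M * (∑ l, w ^ b u l * removedZ w E b u l * min 1 (spread w E b u i l)) +
          ε * (q * pinnedZ w E b) := by
      rw [card_mul_pinnedZ w h.loopless b u, mul_sum, mul_sum, ← sum_add_distrib]
      exact sum_congr rfl fun l _ => by ring
    rw [h2]
    nlinarith [mul_le_mul_of_nonneg_left h1 hM0]
  have ai1 : coef w E b u i * N ≤ 1 := ai.trans si
  have haN : 0 ≤ (coef w E b u i - coef w E b u j) * N := mul_nonneg (sub_nonneg.2 hij) hN0.le
  have hajN : 0 ≤ coef w E b u j * N := mul_nonneg aj0 hN0.le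
  -- If `j` is also likely available, `δ i - δ j` is itself small; otherwise `coef j * N ≤ 0.75` and
  -- the total is `0.75 * 0.05 + 0.95 < 0.993`.
  rcases le_or_gt 0.75 (avail w E b u j) with hj | hj
  · have hs := spread_le_of_avail h hw hw1 hN u i j hi hj
    have h1 := norm_linearPart_le_of_coef_le h hw hw1 hu δ hij
      ((hX i j).trans (show _ ≤ 0.95 * M + ε by nlinarith)) hmean
    calc _ ≤ (coef w E b u j * (0.95 * M + ε) +
          (coef w E b u i - coef w E b u j) * (0.95 * M + ε)) * N := by gcongr
      _ = (coef w E b u i * N) * (0.95 * M + ε) := by ring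
      _ ≤ 1 * (0.95 * M + ε) := by gcongr
      _ ≤ _ := by linarith
  · have h1 := norm_linearPart_le_of_coef_le h hw hw1 hu δ hij (hM i j) hmean
    calc _ ≤ (coef w E b u j * M +
          (coef w E b u i - coef w E b u j) * (0.95 * M + ε)) * N := by gcongr
      _ = (coef w E b u j * N) * (0.05 * M) + (coef w E b u i * N) * (0.95 * M) +
          (coef w E b u i * N - coef w E b u j * N) * ε := by ring
      _ ≤ 0.75 * (0.05 * M) + 1 * (0.95 * M) + 1 * ε := by
          gcongr
          · linarith
          · linarith
      _ ≤ _ := by linarith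

/-- The contraction rate. -/
noncomputable def rate (Δ : ℕ) : ℝ := max 0.996 (1 - 1 / (Δ : ℝ))

lemma rate_lt_one {Δ : ℕ} (hΔ : 3 ≤ Δ) : rate Δ < 1 := by
  have : (0 : ℝ) < 1 / Δ := by
    have : (0 : ℝ) < Δ := by exact_mod_cast (by omega : 0 < Δ)
    positivity
  exact max_lt (by norm_num) (by linarith)

lemma norm_linearPart_le_rate (h : Admissible Δ E b) (hw : 0 ≤ w) (hw1 : w ≤ 1) (hΔ : 3 ≤ Δ)
    (hq : 1.998 * (Δ : ℝ) ≤ q) {u : V} (hu : load E b u + 1 ≤ Δ)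
    (δ : Fin q → ℂ) {M ε : ℝ} (hε : 0 ≤ ε) (hM : ∀ m l, ‖δ m - δ l‖ ≤ M)
    (hX : ∀ m l, ‖δ m - δ l‖ ≤ M * spread w E b u m l + ε) (i j : Fin q) :
    ((Δ : ℝ) - 1) * ‖linearPart w E b u δ i j‖ ≤ rate Δ * M + Δ * ε := by
  have hΔ' : (3 : ℝ) ≤ Δ := by exact_mod_cast hΔ
  have hM0 : 0 ≤ M := (norm_nonneg _).trans (hM i i)
  have hL := norm_nonneg (linearPart w E b u δ i j)
  rcases le_or_gt (2 * Δ) q with h2 | h2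
  · have h2' : 2 * (Δ : ℝ) ≤ q := by exact_mod_cast h2
    have hN : (Δ : ℝ) ≤ (q : ℝ) - Δ := by linarith
    have h3 := norm_linearPart_le_max h hw hw1 hu δ hM i j
    have h4 : max (coef w E b u i) (coef w E b u j) ≤ 1 / (Δ : ℝ) :=
      (max_le (coef_le h hw hw1 hu i) (coef_le h hw hw1 hu j)).trans
        (one_div_le_one_div_of_le (by linarith) hN)
    have h5 : ‖linearPart w E b u δ i j‖ ≤ 1 / (Δ : ℝ) * M :=
      h3.trans (mul_le_mul_of_nonneg_right h4 hM0)
    calc _ ≤ ((Δ : ℝ) - 1) * (1 / (Δ : ℝ) * M) := by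
          gcongr; linarith
      _ = (1 - 1 / (Δ : ℝ)) * M := by field_simp
      _ ≤ rate Δ * M := by gcongr; exact le_max_right _ _
      _ ≤ _ := le_add_of_nonneg_right (by positivity)
  -- By integrality `1.998 * Δ ≤ q ≤ 2 * Δ - 1`, which forces `Δ ≥ 500`. The rate `0.996` then
  -- exceeds `0.993 / 0.998`.
  · have h2' : (q : ℝ) + 1 ≤ 2 * Δ := by exact_mod_cast h2
    have hΔ5 : (500 : ℝ) ≤ Δ := by linarith
    have hN : 499 ≤ (q : ℝ) - Δ := by linarith
    have h3 := norm_linearPart_mul_le h hw hw1 hN hq hu δ hε hM hX i j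
    have h4 : 0.998 * ((Δ : ℝ) - 1) ≤ (q : ℝ) - Δ := by linarith
    have h5 : 0.996 * M ≤ rate Δ * M := by gcongr; exact le_max_left _ _
    nlinarith

end Contraction

/-! ### Complex perturbation: exponents and second order errors. -/

section Perturbation

lemma norm_pow_sub_pow_le {x y : ℂ} {r : ℝ} (hx : ‖x‖ ≤ 2) (hy : ‖y‖ ≤ 1) (hxy : ‖x - y‖ ≤ r)
    (c : ℕ) : ‖x ^ c - y ^ c‖ ≤ 2 ^ c * r := by
  have hr : 0 ≤ r := (norm_nonneg _).trans hxy
  suffices ‖x ^ c - y ^ c‖ ≤ (2 ^ c - 1) * r by nlinarith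
  induction c with
  | zero => simp
  | succ c ih =>
    have h1 : x ^ (c + 1) - y ^ (c + 1) = x * (x ^ c - y ^ c) + (x - y) * y ^ c := by ring
    rw [h1]
    refine (norm_add_le _ _).trans ?_
    rw [norm_mul, norm_mul, norm_pow]
    have h2 : ‖x‖ * ‖x ^ c - y ^ c‖ ≤ 2 * ((2 ^ c - 1) * r) :=
      mul_le_mul hx ih (norm_nonneg _) (by norm_num)
    have h3 : ‖x - y‖ * ‖y‖ ^ c ≤ r * 1 :=
      mul_le_mul hxy (pow_le_one₀ (norm_nonneg _) hy) (by positivity) hr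
    rw [pow_succ]
    linarith

/-- A perturbed convex combination of exponentials is the exponential of the convex combination, up
to second order. -/
lemma exists_exp_eq_sum {ι : Type*} (s : Finset ι) (p : ι → ℝ) (hp : ∀ l ∈ s, 0 ≤ p l)
    (hp1 : ∑ l ∈ s, p l = 1) (δ : ι → ℂ) {M ρ : ℝ} (hM : M ≤ 1 / 8) (hρ : ρ ≤ 1 / 8)
    (hδ : ∀ l ∈ s, ‖δ l‖ ≤ M) {η : ℂ} (hη : ‖η‖ ≤ ρ) :
    ∃ ξ : ℂ, Complex.exp ξ = ∑ l ∈ s, (p l : ℂ) * Complex.exp (δ l) + η ∧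
      ‖ξ - ∑ l ∈ s, (p l : ℂ) * δ l‖ ≤ 9 * M ^ 2 + 2 * ρ := by
  have hM0 : 0 ≤ M := by
    obtain ⟨l, hl⟩ : s.Nonempty := by
      rw [nonempty_iff_ne_empty]
      rintro rfl
      simp at hp1
    exact (norm_nonneg _).trans (hδ l hl)
  have hρ0 : 0 ≤ ρ := (norm_nonneg _).trans hη
  set y : ℂ := ∑ l ∈ s, (p l : ℂ) * (Complex.exp (δ l) - 1) + η with hy
  have hone : ∑ l ∈ s, (p l : ℂ) = 1 := by exact_mod_cast hp1
  have h1 : 1 + y = ∑ l ∈ s, (p l : ℂ) * Complex.exp (δ l) + η := by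
    simp only [hy, mul_sub, mul_one, sum_sub_distrib, hone]
    ring
  have hsum : ∀ (z : ι → ℂ) (B : ℝ), (∀ l ∈ s, ‖z l‖ ≤ B) → ‖∑ l ∈ s, (p l : ℂ) * z l‖ ≤ B := by
    intro z B hz
    calc _ ≤ ∑ l ∈ s, p l * B := by
          refine (norm_sum_le _ _).trans (sum_le_sum fun l hl => ?_)
          rw [norm_mul, Complex.norm_real, Real.norm_of_nonneg (hp l hl)]
          exact mul_le_mul_of_nonneg_left (hz l hl) (hp l hl)
      _ = B := by rw [← sum_mul, hp1, one_mul]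
  have h2 : ‖y - ∑ l ∈ s, (p l : ℂ) * δ l‖ ≤ M ^ 2 + ρ := by
    have : y - ∑ l ∈ s, (p l : ℂ) * δ l =
        ∑ l ∈ s, (p l : ℂ) * (Complex.exp (δ l) - 1 - δ l) + η := by
      simp only [hy, mul_sub, sum_sub_distrib]
      ring
    rw [this]
    refine (norm_add_le _ _).trans (add_le_add (hsum _ _ fun l hl => ?_) hη)
    have h3 := Complex.norm_exp_sub_one_sub_id_le (x := δ l) ((hδ l hl).trans (by linarith))
    exact h3.trans (pow_le_pow_left₀ (norm_nonneg _) (hδ l hl) 2)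
  have h3 : ‖y‖ ≤ 2 * M + ρ := by
    have := norm_sub_norm_le y (∑ l ∈ s, (p l : ℂ) * δ l)
    have := hsum δ M hδ
    nlinarith
  have h4 : ‖y‖ ≤ 1 / 2 := by linarith
  have h5 := Complex.norm_log_one_add_sub_self_le (z := y) (by linarith)
  have h6 : (1 - ‖y‖)⁻¹ ≤ 2 := by
    rw [inv_le_comm₀ (by linarith) (by norm_num)]
    linarith
  have h7 : ‖Complex.log (1 + y) - y‖ ≤ ‖y‖ ^ 2 := by
    refine h5.trans ?_
    nlinarith [sq_nonneg ‖y‖]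
  have hne : 1 + y ≠ 0 := by
    intro h0
    have : y = -1 := by linear_combination h0
    rw [this] at h4
    norm_num at h4
  refine ⟨Complex.log (1 + y), by rw [Complex.exp_log hne, h1], ?_⟩
  have h8 : ‖Complex.log (1 + y) - ∑ l ∈ s, (p l : ℂ) * δ l‖ ≤ ‖y‖ ^ 2 + (M ^ 2 + ρ) := by
    rw [← sub_add_sub_cancel _ y]
    exact (norm_add_le _ _).trans (add_le_add h7 h2)
  have h9 : ‖y‖ ^ 2 ≤ (2 * M + ρ) ^ 2 := pow_le_pow_left₀ (norm_nonneg _) h3 2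
  -- Uses `(2 * M + ρ) ^ 2 ≤ 8 * M ^ 2 + 2 * ρ ^ 2` and `2 * ρ ^ 2 ≤ ρ`.
  nlinarith [sq_nonneg (2 * M - ρ)]

/-- Pairwise small exponents are coherent. -/
lemma norm_sub_le_of_exp {T : Fin q → ℂ} (hT : ∀ l, T l ≠ 0) {B : Fin q → Fin q → ℝ}
    (hB : ∀ m l, B m l ≤ 1) {δ : Fin q → ℂ} {l₀ : Fin q}
    (hδ : ∀ l, T l = T l₀ * Complex.exp (δ l) ∧ ‖δ l‖ ≤ B l l₀)
    (hξ : ∀ m l, ∃ ξ : ℂ, T m = T l * Complex.exp ξ ∧ ‖ξ‖ ≤ B m l) (m l : Fin q) :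
    ‖δ m - δ l‖ ≤ B m l := by
  obtain ⟨ξ, hξ, hξB⟩ := hξ m l
  have h1 : Complex.exp (δ m - δ l) = Complex.exp ξ := by
    rw [Complex.exp_sub, div_eq_iff (Complex.exp_ne_zero _)]
    rw [(hδ m).1, (hδ l).1, mul_assoc] at hξ
    rw [mul_left_cancel₀ (hT l₀) hξ, mul_comm]
  have h2 : ‖δ m - δ l‖ ≤ 2 := (norm_sub_le _ _).trans (by
    linarith [(hδ m).2, (hδ l).2, hB m l₀, hB l l₀])
  have hpi := Real.pi_gt_three
  have him : ∀ z : ℂ, ‖z‖ ≤ 2 → -Real.pi < z.im ∧ z.im ≤ Real.pi := fun z hz => by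
    have := abs_le.1 ((Complex.abs_im_le_norm z).trans hz)
    constructor <;> linarith [this.1, this.2]
  have h3 := him _ h2
  have h4 := him ξ (by linarith [hB m l])
  -- Both exponents have norm at most `2 < π`, so no multiple of `2πi` can separate them.
  rw [Complex.exp_inj_of_neg_pi_lt_of_le_pi h3.1 h3.2 h4.1 h4.2 h1]
  exact hξB

variable {w₀ : ℝ} {w : ℂ} {Δ : ℕ} {E : Finset (Sym2 V)} {b : V → Fin q → ℕ}

/-- The relative change of the partition function. -/
noncomputable def changeZ (w₀ : ℝ) (w : ℂ) (E : Finset (Sym2 V)) (b : V → Fin q → ℕ) : ℂ :=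
  pinnedZ w E b / (pinnedZ w₀ E b : ℝ)

/-- Since `w₀` may be `0`, the change of the weights `w ^ c l` has no logarithm and enters as an
additive error: `2 ^ Δ * r` for the power, `2` for the exponential, summed over `q` colours.
Normalisation costs nothing because `D` is at least the partition function without `u`. -/
lemma exists_exp_eq_sum_pow_mul_removedZ (h : Admissible Δ E b) (hw : 0 ≤ w₀) (hw1 : w₀ ≤ 1)
    {r : ℝ} (hr : r ≤ 1) (hwr : ‖w - w₀‖ ≤ r) (u : V) (c : Fin q → ℕ)
    (hc : (nbr E u).card + ∑ l, c l ≤ Δ) {κ : ℂ} {δ : Fin q → ℂ} {M : ℝ} (hM : M ≤ 1 / 8)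
    (hρ : 2 ^ (Δ + 1) * q * r ≤ 1 / 8) (hδ : ∀ l, ‖δ l‖ ≤ M)
    (hκ : ∀ l, removedZ w E b u l = κ * (removedZ w₀ E b u l : ℝ) * Complex.exp (δ l)) :
    ∃ ξ : ℂ, ∑ l, w ^ c l * removedZ w E b u l =
        κ * ((∑ l, w₀ ^ c l * removedZ w₀ E b u l : ℝ) : ℂ) * Complex.exp ξ ∧
      ‖ξ - ∑ l, ((w₀ ^ c l * removedZ w₀ E b u l / ∑ m, w₀ ^ c m * removedZ w₀ E b u m : ℝ) : ℂ) *
        δ l‖ ≤ 9 * M ^ 2 + 2 * (2 ^ (Δ + 1) * q * r) := by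
  have hr0 : 0 ≤ r := (norm_nonneg _).trans hwr
  have h0 := (h.clear u).pos hw
  have hq0 : (0 : ℝ) < q := by exact_mod_cast (Nat.zero_le _).trans_lt h.lt
  have hN : (1 : ℝ) ≤ (q : ℝ) - Δ := by
    have : ((Δ + 1 : ℕ) : ℝ) ≤ q := by exact_mod_cast h.lt
    push_cast at this
    linarith
  set D : ℝ := ∑ m, w₀ ^ c m * removedZ w₀ E b u m with hD
  have hDge : pinnedZ w₀ (cut E u) (clear b u) ≤ D := by
    refine le_trans ?_ (le_sum_pow_mul_removedZ hw E b u c)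
    have h1 : ((nbr E u).card : ℝ) + ∑ l, (c l : ℝ) ≤ Δ := by exact_mod_cast hc
    have h2 : 0 ≤ ((nbr E u).card : ℝ) + ∑ l, (c l : ℝ) := by positivity
    refine le_mul_of_one_le_left h0.le ?_
    nlinarith
  have hD0 : 0 < D := h0.trans_le hDge
  have hw₀n : ‖(w₀ : ℂ)‖ ≤ 1 := by
    rw [Complex.norm_real, Real.norm_of_nonneg hw]; exact hw1
  have hwn : ‖w‖ ≤ 2 := by
    have := norm_add_le (w - w₀) w₀
    rw [sub_add_cancel] at this
    linarith
  set η : ℂ := ∑ l, (w ^ c l - (w₀ : ℂ) ^ c l) * Complex.exp (δ l) *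
    ((removedZ w₀ E b u l / D : ℝ) : ℂ) with hη
  have hηn : ‖η‖ ≤ 2 ^ (Δ + 1) * q * r := by
    have : ∀ l ∈ (univ : Finset (Fin q)), ‖(w ^ c l - (w₀ : ℂ) ^ c l) * Complex.exp (δ l) *
        ((removedZ w₀ E b u l / D : ℝ) : ℂ)‖ ≤ 2 ^ (Δ + 1) * r := by
      intro l _
      have hY := h.removedZ_pos hw u l
      have h1 : removedZ w₀ E b u l / D ≤ 1 :=
        (div_le_one hD0).2 ((removedZ_le hw hw1 E b u l).trans hDge)
      have h2 : ‖w ^ c l - (w₀ : ℂ) ^ c l‖ ≤ 2 ^ Δ * r := by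
        refine (norm_pow_sub_pow_le hwn hw₀n hwr _).trans ?_
        have : c l ≤ Δ := by
          have := single_le_sum (f := c) (fun _ _ => Nat.zero_le _) (mem_univ l)
          omega
        gcongr
        norm_num
      have h3 : ‖Complex.exp (δ l)‖ ≤ 2 := by
        rw [Complex.norm_exp]
        have h4 : (δ l).re ≤ Real.log 2 := by
          have := (Complex.re_le_norm (δ l)).trans (hδ l)
          have := Real.log_two_gt_d9
          linarith
        calc _ ≤ Real.exp (Real.log 2) := Real.exp_le_exp.2 h4
          _ = 2 := Real.exp_log (by norm_num)
      have h5 : 0 ≤ removedZ w₀ E b u l / D := (div_pos hY hD0).le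
      rw [norm_mul, norm_mul, Complex.norm_real, Real.norm_of_nonneg h5]
      calc _ ≤ (2 ^ Δ * r) * 2 * 1 :=
            mul_le_mul (mul_le_mul h2 h3 (norm_nonneg _) (by positivity)) h1 h5 (by positivity)
        _ = _ := by ring
    refine (norm_sum_le _ _).trans ((sum_le_sum this).trans (le_of_eq ?_))
    simp
    ring
  obtain ⟨ξ, hξ, hξn⟩ := exists_exp_eq_sum univ
    (fun l => w₀ ^ c l * removedZ w₀ E b u l / D)
    (fun l _ => div_nonneg (mul_nonneg (pow_nonneg hw _) (h.removedZ_pos hw u l).le) hD0.le)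
    (by rw [← sum_div, ← hD, div_self hD0.ne']) δ hM hρ (fun l _ => hδ l) hηn
  refine ⟨ξ, ?_, hξn⟩
  rw [hξ, hη, ← sum_add_distrib, mul_sum]
  refine sum_congr rfl fun l _ => ?_
  rw [hκ l]
  have hDc : (D : ℂ) ≠ 0 := by exact_mod_cast hD0.ne'
  push_cast
  field_simp
  ring

lemma changeZ_removed_step {u : V} {i l : Fin q}
    {B : ℕ → ℝ}
    (hB : ∀ k < (nbr E u).card, ∃ ξ : ℂ,
      changeZ w₀ w (cut E u) (stepPins E b u i l k + pin (enum (nbr E u) u k) i) =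
        changeZ w₀ w (cut E u) (stepPins E b u i l k + pin (enum (nbr E u) u k) l) *
          Complex.exp ξ ∧ ‖ξ‖ ≤ B k) :
    ∃ ξ : ℂ, changeZ w₀ w (cut E u) (clear b u + ∑ v ∈ nbr E u, pin v i) =
      changeZ w₀ w (cut E u) (clear b u + ∑ v ∈ nbr E u, pin v l) * Complex.exp ξ ∧
        ‖ξ‖ ≤ ∑ k ∈ range (nbr E u).card, B k := by
  have key : ∀ n ≤ (nbr E u).card, ∃ ξ : ℂ,
      changeZ w₀ w (cut E u) (clear b u + headPins E u i n + tailPins E u l n) =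
        changeZ w₀ w (cut E u) (clear b u + tailPins E u l 0) * Complex.exp ξ ∧
          ‖ξ‖ ≤ ∑ k ∈ range n, B k := by
    intro n
    induction n with
    | zero => exact fun _ => ⟨0, by simp [headPins_zero]⟩
    | succ n ih =>
      intro hn
      obtain ⟨ξ, h1, h2⟩ := ih (by omega)
      obtain ⟨ξ', h3, h4⟩ := hB n hn
      rw [stepPins_add_fst, stepPins_add_snd E b u i l hn, h1] at h3
      refine ⟨ξ + ξ', by rw [h3, Complex.exp_add, mul_assoc], ?_⟩
      rw [sum_range_succ]
      exact (norm_add_le _ _).trans (add_le_add h2 h4)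
  obtain ⟨ξ, h1, h2⟩ := key _ le_rfl
  refine ⟨ξ, ?_, h2⟩
  rwa [headPins_card, tailPins_card, add_zero, tailPins_zero] at h1

end Perturbation

/-! ### Induction on the support. -/

section Induction

variable {w₀ : ℝ} {w : ℂ} {Δ : ℕ} {E : Finset (Sym2 V)} {b : V → Fin q → ℕ}

/-- A pin of colour `i` lowers the weight of `i` only; renormalising multiplies every probability by
`1 + coef` and then takes `coef` away from `i`. Hence the difference for two pins is `linearPart`.
-/
lemma sum_pinned_mul_eq_mean (h : Admissible Δ E b) (hw : 0 ≤ w₀) {u : V}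
    (hu : load E b u + 1 ≤ Δ) (δ : Fin q → ℂ) (i : Fin q) :
    ∑ l, ((w₀ ^ (b u l + if l = i then 1 else 0) * removedZ w₀ E b u l /
        ∑ m, w₀ ^ (b u m + if m = i then 1 else 0) * removedZ w₀ E b u m : ℝ) : ℂ) * δ l =
      mean w₀ E b u δ + (coef w₀ E b u i : ℂ) * (mean w₀ E b u δ - δ i) := by
  have hq : (q : ℝ) ≠ 0 := by exact_mod_cast ((Nat.zero_le _).trans_lt h.lt).ne'
  have hZ := (h.pos hw).ne'
  have hZi := ((h.addPin hu i).pos hw).ne'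
  rw [← card_mul_pinnedZ_add_pin w₀ h.loopless]
  have h1 : ∀ l, w₀ ^ (b u l + if l = i then 1 else 0) * removedZ w₀ E b u l =
      w₀ ^ b u l * removedZ w₀ E b u l -
        if l = i then (1 - w₀) * (w₀ ^ b u i * removedZ w₀ E b u i) else 0 := by
    intro l
    split_ifs with hl
    · subst hl; ring
    · simp
  have h2 : ∀ l, w₀ ^ (b u l + if l = i then 1 else 0) * removedZ w₀ E b u l /
      (q * pinnedZ w₀ E (b + pin u i)) =
      (1 + coef w₀ E b u i) * (w₀ ^ b u l * removedZ w₀ E b u l / (q * pinnedZ w₀ E b)) -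
        if l = i then coef w₀ E b u i else 0 := by
    intro l
    have h3 : coef w₀ E b u i = (1 - w₀) * (w₀ ^ b u i * removedZ w₀ E b u i) /
        (q * pinnedZ w₀ E (b + pin u i)) := by
      rw [← coef_eq h hw hu i, mul_div_cancel_right₀ _ (mul_ne_zero hq hZi)]
    have h4 : 1 + coef w₀ E b u i = pinnedZ w₀ E b / pinnedZ w₀ E (b + pin u i) := by
      rw [coef]; ring
    rw [h1, sub_div, h4, h3]
    congr 1
    · field_simp
    · split_ifs <;> simp
  simp_rw [h2]
  push_cast
  simp_rw [sub_mul, sum_sub_distrib, mul_assoc, ← mul_sum]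
  have h5 : ∑ l, (((if l = i then coef w₀ E b u i else 0 : ℝ)) : ℂ) * δ l =
      (coef w₀ E b u i : ℂ) * δ i := by
    rw [sum_eq_single i] <;> simp +contextual
  rw [h5, mean]
  push_cast
  ring

/-- Control on the relative change of the partition functions around `u`: the colour-dependent parts
of the changes are close to one another. -/
def Controlled (w₀ : ℝ) (w : ℂ) (M ε : ℝ) (E : Finset (Sym2 V)) (b : V → Fin q → ℕ) (u : V) : Prop :=
  ∃ (κ : ℂ) (δ : Fin q → ℂ), κ ≠ 0 ∧
    (∀ l, removedZ w E b u l = κ * (removedZ w₀ E b u l : ℝ) * Complex.exp (δ l)) ∧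
    (∀ l, ‖δ l‖ ≤ M) ∧ (∀ m l, ‖δ m - δ l‖ ≤ M) ∧
    ∀ m l, ‖δ m - δ l‖ ≤ M * spread w₀ E b u m l + ε

/-- The second order error. -/
noncomputable def secondOrder (Δ q : ℕ) (M r : ℝ) : ℝ := 9 * M ^ 2 + 2 * (2 ^ (Δ + 1) * q * r)

lemma exists_exp_eq_pinnedZ_add_pin (h : Admissible Δ E b) (hw : 0 ≤ w₀) (hw1 : w₀ ≤ 1)
    {r : ℝ} (hr : r ≤ 1) (hwr : ‖w - w₀‖ ≤ r) {u : V} (hu : load E b u + 1 ≤ Δ) {κ : ℂ}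
    {δ : Fin q → ℂ} {M : ℝ} (hM : M ≤ 1 / 8) (hρ : 2 ^ (Δ + 1) * q * r ≤ 1 / 8)
    (hδ : ∀ l, ‖δ l‖ ≤ M)
    (hκ : ∀ l, removedZ w E b u l = κ * (removedZ w₀ E b u l : ℝ) * Complex.exp (δ l))
    (i : Fin q) :
    ∃ ξ : ℂ, changeZ w₀ w E (b + pin u i) = κ * Complex.exp ξ ∧
      ‖ξ - (mean w₀ E b u δ + (coef w₀ E b u i : ℂ) * (mean w₀ E b u δ - δ i))‖ ≤
        secondOrder Δ q M r := by
  have hq : (q : ℂ) ≠ 0 := by exact_mod_cast ((Nat.zero_le _).trans_lt h.lt).ne'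
  have hc : (nbr E u).card + ∑ l, (b u l + if l = i then 1 else 0) ≤ Δ := by
    rw [sum_add_distrib]
    simp only [sum_ite_eq', mem_univ, if_true]
    rw [load] at hu
    omega
  obtain ⟨ξ, h1, h2⟩ := exists_exp_eq_sum_pow_mul_removedZ h hw hw1 hr hwr u _ hc hM hρ hδ hκ
  rw [sum_pinned_mul_eq_mean h hw hu] at h2
  refine ⟨ξ, ?_, h2⟩
  rw [← card_mul_pinnedZ_add_pin w h.loopless, ← card_mul_pinnedZ_add_pin w₀ h.loopless] at h1
  have hZ : ((pinnedZ w₀ E (b + pin u i) : ℝ) : ℂ) ≠ 0 := by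
    exact_mod_cast ((h.addPin hu i).pos hw).ne'
  rw [changeZ, div_eq_iff hZ]
  refine mul_left_cancel₀ hq ?_
  rw [h1]
  push_cast
  ring

/-- Two bounds are needed: the one through `coef` adds up to `spread` one level higher, the one
through `rate` closes the induction. -/
lemma Controlled.exists_exp_eq (h : Admissible Δ E b) (hw : 0 ≤ w₀) (hw1 : w₀ ≤ 1) (hΔ : 3 ≤ Δ)
    (hq : 1.998 * (Δ : ℝ) ≤ q) {r : ℝ} (hr : r ≤ 1) (hwr : ‖w - w₀‖ ≤ r) {u : V}
    (hu : load E b u + 1 ≤ Δ) {M ε : ℝ} (hM : M ≤ 1 / 8) (hε : 0 ≤ ε)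
    (hρ : 2 ^ (Δ + 1) * q * r ≤ 1 / 8) (hC : Controlled w₀ w M ε E b u) (i j : Fin q) :
    ∃ ξ : ℂ, changeZ w₀ w E (b + pin u i) = changeZ w₀ w E (b + pin u j) * Complex.exp ξ ∧
      ‖ξ‖ ≤ max (coef w₀ E b u i) (coef w₀ E b u j) * M + 2 * secondOrder Δ q M r ∧
      ((Δ : ℝ) - 1) * ‖ξ‖ ≤ rate Δ * M + Δ * ε + ((Δ : ℝ) - 1) * (2 * secondOrder Δ q M r) := by
  obtain ⟨κ, δ, -, hκ, hδ, hδM, hδX⟩ := hC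
  obtain ⟨ξi, hi, hi'⟩ := exists_exp_eq_pinnedZ_add_pin h hw hw1 hr hwr hu hM hρ hδ hκ i
  obtain ⟨ξj, hj, hj'⟩ := exists_exp_eq_pinnedZ_add_pin h hw hw1 hr hwr hu hM hρ hδ hκ j
  have hΔ' : (3 : ℝ) ≤ Δ := by exact_mod_cast hΔ
  have h1 : ‖ξi - ξj‖ ≤ ‖linearPart w₀ E b u δ i j‖ + 2 * secondOrder Δ q M r := by
    have : ξi - ξj = linearPart w₀ E b u δ i j +
        ((ξi - (mean w₀ E b u δ + (coef w₀ E b u i : ℂ) * (mean w₀ E b u δ - δ i))) -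
          (ξj - (mean w₀ E b u δ + (coef w₀ E b u j : ℂ) * (mean w₀ E b u δ - δ j)))) := by
      rw [linearPart]; ring
    rw [this]
    refine (norm_add_le _ _).trans (add_le_add_right ((norm_sub_le _ _).trans ?_) _)
    linarith
  refine ⟨ξi - ξj, ?_, ?_, ?_⟩
  · rw [hi, hj, Complex.exp_sub]
    field_simp
  · exact h1.trans (add_le_add_left (norm_linearPart_le_max h hw hw1 hu δ hδM i j) _)
  · have h2 := norm_linearPart_le_rate h hw hw1 hΔ hq hu δ hε hδM hδX i j
    have h3 := mul_le_mul_of_nonneg_left h1 (by linarith : (0 : ℝ) ≤ (Δ : ℝ) - 1)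
    linarith

lemma load_cut_self (E : Finset (Sym2 V)) (b c : V → Fin q → ℕ) (u : V) :
    load (cut E u) (clear b u + c) u = ∑ l, c u l := by
  simp [load, nbr_cut_self, clear_self]

lemma load_removed_self (hE : Loopless E) (b : V → Fin q → ℕ) (u : V) (l : Fin q) :
    load (cut E u) (clear b u + ∑ v ∈ nbr E u, pin v l) u = 0 := by
  rw [load_cut_self]
  simp only [Finset.sum_apply]
  rw [sum_comm]
  refine sum_eq_zero fun v hv => ?_
  have : v ≠ u := by rintro rfl; exact hE.not_mem_nbr v hv
  rw [sum_pin, if_neg this]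

lemma Loopless.enum_nbr_ne (hE : Loopless E) {u : V} {k : ℕ} (hk : k < (nbr E u).card) :
    enum (nbr E u) u k ≠ u :=
  ne_of_mem_of_not_mem (enum_mem u hk) (hE.not_mem_nbr u)

lemma load_stepPins_self (hE : Loopless E) (b : V → Fin q → ℕ) (u : V) (i l : Fin q) {k : ℕ}
    (hk : k < (nbr E u).card) : load (cut E u) (stepPins E b u i l k) u = 0 := by
  rw [stepPins, add_assoc, load_cut_self]
  simp only [headPins, tailPins, Pi.add_apply, Finset.sum_apply, sum_add_distrib]
  have key : ∀ (s : Finset ℕ) (j : Fin q), (∀ m ∈ s, m < (nbr E u).card) →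
      ∑ x, ∑ m ∈ s, pin (enum (nbr E u) u m) j u x = 0 := by
    intro s j hs
    rw [sum_comm]
    refine sum_eq_zero fun m hm => ?_
    rw [sum_pin, if_neg (hE.enum_nbr_ne (hs m hm))]
  rw [key _ _ fun m hm => (mem_range.1 hm).trans hk, key _ _ fun m hm => (mem_Ico.1 hm).2]

/-- All partition functions supported on `S` are nonzero and controlled. -/
def GoodOn (Δ q : ℕ) (w₀ : ℝ) (w : ℂ) (M ε : ℝ) (S : Finset V) : Prop :=
  ∀ (E : Finset (Sym2 V)) (b : V → Fin q → ℕ), Admissible Δ E b → (∀ v ∉ S, load E b v = 0) →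
    pinnedZ w E b ≠ 0 ∧ ∀ u ∈ S, load E b u + 1 ≤ Δ → Controlled w₀ w M ε E b u

lemma pinnedZ_ne_zero_of_load_eq_zero (w : ℂ) (hq : 0 < q) (hb : ∀ v, load E b v = 0) :
    pinnedZ w E b ≠ 0 := by
  have hE : E = ∅ := by
    refine eq_empty_of_forall_notMem fun e he => ?_
    induction e with
    | _ x y =>
      have h1 := hb x
      rw [load, add_eq_zero, card_eq_zero] at h1
      exact absurd (mem_nbr.2 he) (by simp [h1.1])
  have hb0 : ∀ v l, b v l = 0 := fun v l => by
    have h1 := hb v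
    rw [load, add_eq_zero, sum_eq_zero_iff] at h1
    exact h1.2 l (mem_univ l)
  simp [pinnedZ, cost, hE, hb0, hq.ne']

/-- The parameters of the induction: `M` bounds the changes, `r` is the radius around the real
point. -/
structure Parameters (Δ q : ℕ) (M r : ℝ) : Prop where
  three_le : 3 ≤ Δ
  le_card : 1.998 * (Δ : ℝ) ≤ q
  M_pos : 0 < M
  M_le : M ≤ 1 / 16
  r_pos : 0 < r
  r_le : r ≤ 1
  rho_le : 2 ^ (Δ + 1) * q * r ≤ 1 / 8
  contract : rate Δ * M + Δ * (2 * Δ * secondOrder Δ q M r) + Δ * (2 * secondOrder Δ q M r) ≤ M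

lemma Parameters.secondOrder_nonneg {M r : ℝ} (hp : Parameters Δ q M r) :
    0 ≤ secondOrder Δ q M r := by
  have := hp.r_pos
  rw [secondOrder]; positivity

lemma Parameters.lt {M r : ℝ} (hp : Parameters Δ q M r) : Δ < q := by
  have h1 : (3 : ℝ) ≤ Δ := by exact_mod_cast hp.three_le
  have h2 := hp.le_card
  have : (Δ : ℝ) < q := by linarith
  exact_mod_cast this

/-- Every switch takes place in a graph where `u` has load zero, hence supported on `S.erase u`.
Each costs at most `M / (Δ - 1)` by contraction, and also at most its term of `spread` plus a second
order error; at most `Δ` such errors occur. -/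
lemma GoodOn.exists_exp_eq_removed {M r : ℝ} (hp : Parameters Δ q M r) (hw : 0 ≤ w₀)
    (hw1 : w₀ ≤ 1) (hwr : ‖w - w₀‖ ≤ r) {S : Finset V} {u : V}
    (hS : GoodOn Δ q w₀ w M (2 * Δ * secondOrder Δ q M r) (S.erase u))
    (h : Admissible Δ E b) (hsupp : ∀ v ∉ S, load E b v = 0) (i l : Fin q) :
    ∃ ξ : ℂ, changeZ w₀ w (cut E u) (clear b u + ∑ v ∈ nbr E u, pin v i) =
      changeZ w₀ w (cut E u) (clear b u + ∑ v ∈ nbr E u, pin v l) * Complex.exp ξ ∧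
      ((Δ : ℝ) - 1) * ‖ξ‖ ≤ (nbr E u).card * M ∧
      ‖ξ‖ ≤ M * spread w₀ E b u i l + 2 * Δ * secondOrder Δ q M r := by
  have hτ := hp.secondOrder_nonneg
  have hΔ' : (3 : ℝ) ≤ Δ := by exact_mod_cast hp.three_le
  have hf : ((nbr E u).card : ℝ) ≤ Δ := by
    have h1 := h.load_le u
    rw [load] at h1
    exact_mod_cast (Nat.le_add_right _ _).trans h1
  have hsuppE : ∀ k < (nbr E u).card, ∀ v ∉ S.erase u,
      load (cut E u) (stepPins E b u i l k) v = 0 := by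
    intro k hk v hv
    by_cases hvu : v = u
    · subst hvu; exact load_stepPins_self h.loopless b v i l hk
    · have h1 := load_stepPins h.loopless b u i l hk v
      rw [hsupp v fun hvS => hv (mem_erase.2 ⟨hvu, hvS⟩)] at h1
      omega
  have hmem : ∀ k < (nbr E u).card, enum (nbr E u) u k ∈ S.erase u := by
    intro k hk
    by_contra hv
    have h1 := enum_mem u hk
    have h3 := hsupp _ fun hvS => hv (mem_erase.2 ⟨h.loopless.enum_nbr_ne hk, hvS⟩)
    rw [load, add_eq_zero, card_eq_zero] at h3
    have h4 : u ∈ nbr E (enum (nbr E u) u k) := by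
      rw [mem_nbr, Sym2.eq_swap]; exact mem_nbr.1 h1
    rw [h3.1] at h4
    simp at h4
  set β : ℕ → ℝ := fun k => min (M / ((Δ : ℝ) - 1))
    (max (coef w₀ (cut E u) (stepPins E b u i l k) (enum (nbr E u) u k) i)
      (coef w₀ (cut E u) (stepPins E b u i l k) (enum (nbr E u) u k) l) * M +
        2 * secondOrder Δ q M r) with hβ
  obtain ⟨ξ, h1, h2⟩ := changeZ_removed_step (w₀ := w₀) (w := w) (E := E) (b := b) (u := u)
    (i := i) (l := l) (B := β) fun k hk => by
      have hA := h.step u i l hk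
      have hl := h.load_step u i l hk
      have hC := (hS _ _ hA (hsuppE k hk)).2 _ (hmem k hk) hl
      obtain ⟨ξ, h1, h2, h3⟩ := hC.exists_exp_eq hA hw hw1 hp.three_le hp.le_card hp.r_le hwr hl
        (by linarith [hp.M_le]) (by positivity) hp.rho_le i l
      refine ⟨ξ, h1, le_min ?_ h2⟩
      rw [le_div_iff₀ (by linarith)]
      have := hp.contract
      linarith
  refine ⟨ξ, h1, ?_, ?_⟩
  · have h3 : ‖ξ‖ ≤ (nbr E u).card * (M / ((Δ : ℝ) - 1)) := by
      refine h2.trans ((sum_le_sum fun k _ => min_le_left _ _).trans (le_of_eq ?_))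
      simp
    calc _ ≤ ((Δ : ℝ) - 1) * ((nbr E u).card * (M / ((Δ : ℝ) - 1))) :=
          mul_le_mul_of_nonneg_left h3 (by linarith)
      _ = _ := by
          have : (Δ : ℝ) - 1 ≠ 0 := by linarith
          field_simp
  · refine h2.trans ((sum_le_sum fun k _ => min_le_right _ _).trans ?_)
    rw [sum_add_distrib, ← sum_mul, ← spread, sum_const, card_range, nsmul_eq_mul, mul_comm M]
    nlinarith

/-- Removing a vertex preserves goodness. -/
lemma GoodOn.of_erase {M r : ℝ} (hp : Parameters Δ q M r) (hw : 0 ≤ w₀)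
    (hw1 : w₀ ≤ 1) (hwr : ‖w - w₀‖ ≤ r) {S : Finset V}
    (hS : ∀ u ∈ S, GoodOn Δ q w₀ w M (2 * Δ * secondOrder Δ q M r) (S.erase u)) :
    GoodOn Δ q w₀ w M (2 * Δ * secondOrder Δ q M r) S := by
  intro E b h hsupp
  have hΔ' : (3 : ℝ) ≤ Δ := by exact_mod_cast hp.three_le
  have hM := hp.M_le
  have hM0 := hp.M_pos
  have hq0 : 0 < q := (Nat.zero_le _).trans_lt hp.lt
  have hne : ∀ u ∈ S, ∀ l, removedZ w E b u l ≠ 0 := by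
    intro u hu l
    refine (hS u hu _ _ (h.removed u l) fun v hv => ?_).1
    by_cases hvu : v = u
    · subst hvu; exact load_removed_self h.loopless b v l
    · have h1 := load_add_pins h.loopless b u l v
      rw [hsupp v fun hvS => hv (mem_erase.2 ⟨hvu, hvS⟩)] at h1
      omega
  have hrne : ∀ u l, ((removedZ w₀ E b u l : ℝ) : ℂ) ≠ 0 := fun u l => by
    exact_mod_cast (h.removedZ_pos hw u l).ne'
  have hcne : ∀ u ∈ S, ∀ l, changeZ w₀ w (cut E u) (clear b u + ∑ v ∈ nbr E u, pin v l) ≠ 0 :=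
    fun u hu l => div_ne_zero (hne u hu l) (hrne u l)
  have hrem : ∀ u l, removedZ w E b u l =
      changeZ w₀ w (cut E u) (clear b u + ∑ v ∈ nbr E u, pin v l) *
        (removedZ w₀ E b u l : ℝ) := fun u l => (div_mul_cancel₀ _ (hrne u l)).symm
  constructor
  · rcases S.eq_empty_or_nonempty with rfl | ⟨u, hu⟩
    · exact pinnedZ_ne_zero_of_load_eq_zero w hq0 fun v => hsupp v (notMem_empty v)
    have hload := h.load_le u
    rw [load] at hload
    have key := fun l => (hS u hu).exists_exp_eq_removed hp hw hw1 hwr h hsupp l ⟨0, hq0⟩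
    choose δ hδ hδ1 _ using key
    -- Here `u` may have `Δ` neighbours, so only `Δ / (Δ - 1) * M ≤ 2 * M` is available; this is
    -- enough for nonvanishing since `2 * M ≤ 1 / 8`.
    have hδ2 : ∀ l, ‖δ l‖ ≤ 2 * M := by
      intro l
      have h1 := hδ1 l
      have hf : ((nbr E u).card : ℝ) ≤ Δ := by
        exact_mod_cast (Nat.le_add_right _ _).trans hload
      nlinarith [norm_nonneg (δ l)]
    obtain ⟨ξ, h1, -⟩ := exists_exp_eq_sum_pow_mul_removedZ h hw hw1 hp.r_le hwr u (b u) hload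
      (κ := changeZ w₀ w (cut E u) (clear b u + ∑ v ∈ nbr E u, pin v ⟨0, hq0⟩)) (δ := δ)
      (M := 2 * M) (by linarith) hp.rho_le hδ2 fun l => by rw [hrem, hδ]; ring
    rw [← card_mul_pinnedZ w h.loopless, ← card_mul_pinnedZ w₀ h.loopless] at h1
    refine right_ne_zero_of_mul (a := (q : ℂ)) ?_
    rw [h1]
    refine mul_ne_zero (mul_ne_zero (hcne u hu _) ?_) (Complex.exp_ne_zero _)
    have := h.pos hw
    have : (0 : ℝ) < q := by exact_mod_cast hq0
    exact_mod_cast (by positivity : (0 : ℝ) < q * pinnedZ w₀ E b).ne'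
  · intro u hu hload
    have key : ∀ m l, ∃ ξ : ℂ, changeZ w₀ w (cut E u) (clear b u + ∑ v ∈ nbr E u, pin v m) =
        changeZ w₀ w (cut E u) (clear b u + ∑ v ∈ nbr E u, pin v l) * Complex.exp ξ ∧
        ‖ξ‖ ≤ min M (M * spread w₀ E b u m l + 2 * Δ * secondOrder Δ q M r) := by
      intro m l
      obtain ⟨ξ, h1, h2, h3⟩ := (hS u hu).exists_exp_eq_removed hp hw hw1 hwr h hsupp m l
      refine ⟨ξ, h1, le_min ?_ h3⟩
      -- The spare unit of load leaves at most `Δ - 1` neighbours, so the bound `M` is reproduced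
      -- exactly.
      have hf : ((nbr E u).card : ℝ) ≤ Δ - 1 := by
        have : (nbr E u).card + 1 ≤ Δ := by rw [load] at hload; omega
        have : ((nbr E u).card : ℝ) + 1 ≤ Δ := by exact_mod_cast this
        linarith
      refine le_of_mul_le_mul_left (h2.trans ?_) (by linarith : (0 : ℝ) < Δ - 1)
      exact mul_le_mul_of_nonneg_right hf hM0.le
    choose δ hδ using fun l => key l ⟨0, hq0⟩
    have hB := norm_sub_le_of_exp
      (T := fun l => changeZ w₀ w (cut E u) (clear b u + ∑ v ∈ nbr E u, pin v l))
      (B := fun m l => min M (M * spread w₀ E b u m l + 2 * Δ * secondOrder Δ q M r))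
      (hcne u hu) (fun m l => (min_le_left _ _).trans (by linarith)) hδ key
    exact ⟨changeZ w₀ w (cut E u) (clear b u + ∑ v ∈ nbr E u, pin v ⟨0, hq0⟩), δ, hcne u hu ⟨0, hq0⟩, fun l => by rw [hrem, (hδ l).1]; ring,
      fun l => (hδ l).2.trans (min_le_left _ _), fun m l => (hB m l).trans (min_le_left _ _),
      fun m l => (hB m l).trans (min_le_right _ _)⟩

lemma goodOn {M r : ℝ} (hp : Parameters Δ q M r) (hw : 0 ≤ w₀) (hw1 : w₀ ≤ 1)
    (hwr : ‖w - w₀‖ ≤ r) (S : Finset V) :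
    GoodOn Δ q w₀ w M (2 * Δ * secondOrder Δ q M r) S := by
  induction S using Finset.strongInduction with
  | H S ih => exact GoodOn.of_erase hp hw hw1 hwr fun u hu => ih _ (erase_ssubset hu)

lemma exists_parameters (hΔ : 3 ≤ Δ) (hq : 1.998 * (Δ : ℝ) ≤ q) :
    ∃ M r : ℝ, Parameters Δ q M r := by
  have hΔ' : (3 : ℝ) ≤ Δ := by exact_mod_cast hΔ
  have hq0 : (1 : ℝ) ≤ q := by linarith
  have hrate := rate_lt_one hΔ
  have hrate0 : 0.996 ≤ rate Δ := le_max_left _ _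
  -- With `r` as below the second order error is `10 * M ^ 2`, entering `contract` with factor `2 *
  -- Δ ^ 2 + 2 * Δ ≤ 4 * Δ ^ 2`; hence the `40`.
  set M : ℝ := (1 - rate Δ) / (40 * (Δ : ℝ) ^ 2) with hM
  have hM0 : 0 < M := by
    have : 0 < 1 - rate Δ := by linarith
    positivity
  have hMeq : M * (40 * (Δ : ℝ) ^ 2) = 1 - rate Δ := by
    rw [hM]; field_simp
  have hM16 : M ≤ 1 / 16 := by nlinarith
  have hA : (1 : ℝ) ≤ 2 ^ (Δ + 1) * q :=
    one_le_mul_of_one_le_of_one_le (one_le_pow₀ (by norm_num)) hq0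
  set r : ℝ := M ^ 2 / (2 * (2 ^ (Δ + 1) * q)) with hr
  have hr2 : 2 ^ (Δ + 1) * q * r = M ^ 2 / 2 := by
    rw [hr]; field_simp
  have hr0 : 0 < r := by rw [hr]; positivity
  have hM2 : M ^ 2 ≤ 1 / 16 := by nlinarith
  refine ⟨M, r, hΔ, hq, hM0, hM16, hr0, by nlinarith, by rw [hr2]; linarith, ?_⟩
  have hs : secondOrder Δ q M r = 10 * M ^ 2 := by
    rw [secondOrder, hr2]; ring
  rw [hs]
  nlinarith [mul_nonneg hM0.le hM0.le, mul_nonneg (mul_nonneg hM0.le hM0.le)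
    (mul_nonneg (by linarith : (0 : ℝ) ≤ Δ) (by linarith : (0 : ℝ) ≤ (Δ : ℝ) - 1))]

end Induction

end PinnedPotts

theorem theorem1p1 :
    ∃ η : ℝ, 0.002 ≤ η ∧
      ∀ Δ q : ℕ, 3 ≤ Δ → (2 - η) * (Δ : ℝ) ≤ (q : ℝ) →
        ∃ U : Set ℂ, IsOpen U ∧ (∀ t : ℝ, 0 ≤ t → t ≤ 1 → (t : ℂ) ∈ U) ∧
          ∀ w ∈ U, ∀ (V : Type*) [Fintype V] [DecidableEq V] (G : SimpleGraph V)
            [DecidableRel G.Adj], G.maxDegree ≤ Δ → pottsZ G q w ≠ 0 := by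
  refine ⟨0.002, le_rfl, fun Δ q hΔ hq => ?_⟩
  obtain ⟨M, r, hp⟩ := PinnedPotts.exists_parameters hΔ (q := q) (by norm_num at hq ⊢; exact hq)
  -- The radius `r` depends on `Δ` and `q` only, so one neighbourhood serves all graphs.
  refine ⟨⋃ t ∈ Set.Icc (0 : ℝ) 1, Metric.ball (t : ℂ) r,
    isOpen_biUnion fun t _ => Metric.isOpen_ball, fun t h0 h1 => ?_, ?_⟩
  · exact Set.mem_biUnion (Set.mem_Icc.2 ⟨h0, h1⟩) (Metric.mem_ball_self hp.r_pos)
  · intro w hwU V _ _ G _ hG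
    obtain ⟨t, ht, hwt⟩ := Set.mem_iUnion₂.1 hwU
    rw [PinnedPotts.pottsZ_eq_pinnedZ]
    have hE : PinnedPotts.Loopless G.edgeFinset := fun v hv => by simp at hv
    have hload : ∀ v, PinnedPotts.load (q := q) G.edgeFinset 0 v ≤ Δ := by
      intro v
      refine le_trans (le_of_eq ?_) ((G.degree_le_maxDegree v).trans hG)
      have : PinnedPotts.nbr G.edgeFinset v = G.neighborFinset v := by
        ext x; simp [PinnedPotts.mem_nbr]
      simp [PinnedPotts.load, this]
    exact (PinnedPotts.goodOn hp ht.1 ht.2 (mem_ball_iff_norm.1 hwt).le Finset.univ _ _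
      ⟨hE, hload, hp.lt⟩ (by simp)).1
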